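/- Let $\phi=\frac{1+\sqrt5}{2}$. The golden L is the translation surface obtained from the L-shaped region $([0,\phi]\times[0,1])\cup([0,1]\times[0,\phi])$ by gluing opposite sides by horizontal and vertical translations: $(0,y)\sim(\phi,y)$ for $0\le y\le 1$, $(0,y)\sim(1,y)$ for $1\le y\le\phi$, $(x,0)\sim(x,\phi)$ for $0\le x\le 1$, and $(x,0)\sim(x,1)$ for $1\le x\le\phi$. It has one singular point, the common image of $(0,0),(1,0),(\phi,0),(\phi,1),(1,1),(1,\phi),(0,\phi),(0,1)$. A saddle connection vector is the (nonzero) holonomy vector of a straight path that starts and ends at the singular point and does not meet it in between; it is called long if it is longest among the saddle connection vectors in its direction. A cylinder vector is the holonomy vector of a periodic straight trajectory (traversed once) that avoids the singular point; it is called short if it is shortest among the cylinder vectors in its direction. Let $$\sigma_0=\begin{pmatrix}1&\phi\\0&1\end{pmatrix},\quad \sigma_1=\begin{pmatrix}\phi&\phi\\1&\phi\end{pmatrix},\quad \sigma_2=\begin{pmatrix}\phi&1\\\phi&\phi\end{pmatrix},\quad \sigma_3=\begin{pmatrix}1&0\\\phi&1\end{pmatrix},$$ and for a finite (possibly empty)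 word $w=k_1k_2\cdots k_n$ in the letters $0,1,2,3$ let $m(w)=\sigma_{k_n}\cdots\sigma_{k_2}\sigma_{k_1}$, with $m$ of the empty word the identity matrix. Theorem. The long saddle connection vectors of the golden L are exactly its short cylinder vectors. Let $\Lambda$ be the set of those that lie in the first quadrant $\Sigma=\{(x,y): x>0,\ y\ge 0\}$. Then $$\Lambda=\Bigl\{\,m(w)\begin{pmatrix}1\\0\end{pmatrix} : w \text{ a finite word in } 0,1,2,3\,\Bigr\},$$ and $w\mapsto m(w)\begin{pmatrix}1\\0\end{pmatrix}$ is a bijection from the set of words that do not start with $0$ (that is, $w$ is empty or $k_1\neq 0$) onto $\Lambda$. -/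

import Mathlib

namespace GoldenL

open scoped goldenRatio Matrix

/-- The closed L-shaped region in the plane: the unit square `[0,1] × [0,1]` with a
`φ⁻¹ × 1` rectangle attached on its right and a `1 × φ⁻¹` rectangle attached on top of it
(recall `1 + φ⁻¹ = φ`). -/
def region : Set (Fin 2 → ℝ) :=
  {p | (0 ≤ p 0 ∧ p 0 ≤ φ ∧ 0 ≤ p 1 ∧ p 1 ≤ 1) ∨ (0 ≤ p 0 ∧ p 0 ≤ 1 ∧ 0 ≤ p 1 ∧ p 1 ≤ φ)}

/-- The side identifications of the golden L: opposite parallel sides are glued by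
horizontal or vertical translations. -/
inductive Glue : region → region → Prop
  /-- The sides `{0} × [0,1]` and `{φ} × [0,1]`. -/
  | horizontal_long (p q : region) (hp : p.1 0 = 0) (hq : q.1 0 = φ)
      (h : p.1 1 = q.1 1) (hy : p.1 1 ≤ 1) : Glue p q
  /-- The sides `{0} × [1,φ]` and `{1} × [1,φ]`. -/
  | horizontal_short (p q : region) (hp : p.1 0 = 0) (hq : q.1 0 = 1)
      (h : p.1 1 = q.1 1) (hy : 1 ≤ p.1 1) : Glue p q
  /-- The sides `[0,1] × {0}` and `[0,1] × {φ}`. -/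
  | vertical_long (p q : region) (hp : p.1 1 = 0) (hq : q.1 1 = φ)
      (h : p.1 0 = q.1 0) (hx : p.1 0 ≤ 1) : Glue p q
  /-- The sides `[1,φ] × {0}` and `[1,φ] × {1}`. -/
  | vertical_short (p q : region) (hp : p.1 1 = 0) (hq : q.1 1 = 1)
      (h : p.1 0 = q.1 0) (hx : 1 ≤ p.1 0) : Glue p q

/-- The golden L: the quotient of the L-shaped region by the equivalence relation generated
by the side identifications. -/
def Surface : Type := Quot Glue

/-- The quotient map from the region to the surface. -/
def mk (p : region) : Surface := Quot.mk Glue p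

theorem zero_mem_region : (0 : Fin 2 → ℝ) ∈ region :=
  Or.inl ⟨le_rfl, Real.goldenRatio_pos.le, le_rfl, zero_le_one⟩

/-- The singular point (cone point) of the golden L: the common image of the eight points
`(0,0), (1,0), (φ,0), (φ,1), (1,1), (1,φ), (0,φ), (0,1)` of the boundary of the region. -/
def singularPoint : Surface := mk ⟨0, zero_mem_region⟩

/-- Just after time `t`, the path `γ` runs along a straight segment of the region with
velocity `v`. -/
def StraightAfter (v : Fin 2 → ℝ) (γ : ℝ → Surface) (t : ℝ) : Prop :=
  ∃ p : Fin 2 → ℝ, ∃ ε > 0, ∀ s ∈ Set.Icc (0 : ℝ) ε,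
    ∃ h : p + s • v ∈ region, γ (t + s) = mk ⟨p + s • v, h⟩

/-- Just before time `t`, the path `γ` runs along a straight segment of the region with
velocity `v`. The representative `p` of `γ t` may differ from the one used after time `t`,
namely when `γ` crosses a glued side at time `t`. -/
def StraightBefore (v : Fin 2 → ℝ) (γ : ℝ → Surface) (t : ℝ) : Prop :=
  ∃ p : Fin 2 → ℝ, ∃ ε > 0, ∀ s ∈ Set.Icc (0 : ℝ) ε,
    ∃ h : p - s • v ∈ region, γ (t - s) = mk ⟨p - s • v, h⟩

/-- The set of saddle connection vectors: the holonomy vectors `v` of straight paths on the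
golden L (parametrized by `[0,1]`, with constant velocity `v ≠ 0`) that start and end at the
singular point and do not meet it in between. -/
def saddleConnectionVectors : Set (Fin 2 → ℝ) :=
  {v | v ≠ 0 ∧ ∃ γ : ℝ → Surface,
    γ 0 = singularPoint ∧ γ 1 = singularPoint ∧
    (∀ t ∈ Set.Ioo (0 : ℝ) 1, γ t ≠ singularPoint) ∧
    (∀ t ∈ Set.Ico (0 : ℝ) 1, StraightAfter v γ t) ∧
    (∀ t ∈ Set.Ioc (0 : ℝ) 1, StraightBefore v γ t)}

/-- The long saddle connection vectors: those that are longest among the saddle connection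
vectors in the same direction. -/
def longSaddleConnectionVectors : Set (Fin 2 → ℝ) :=
  {v | v ∈ saddleConnectionVectors ∧
    ∀ c : ℝ, 0 < c → c • v ∈ saddleConnectionVectors → c ≤ 1}

/-- The set of cylinder vectors: the holonomy vectors `v` of periodic trajectories of the
linear flows on the golden L. Such a trajectory avoids the singular point and, when it is
parametrized with velocity `v ≠ 0`, its least positive period is `1`. A cylinder is a maximal
family of parallel periodic trajectories, and all of them have the same holonomy vector. -/
def cylinderVectors : Set (Fin 2 → ℝ) :=
  {v | v ≠ 0 ∧ ∃ γ : ℝ → Surface,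
    (∀ t, γ t ≠ singularPoint) ∧
    (∀ t, StraightAfter v γ t) ∧ (∀ t, StraightBefore v γ t) ∧
    Function.Periodic γ 1 ∧ ∀ s ∈ Set.Ioo (0 : ℝ) 1, ¬ Function.Periodic γ s}

/-- The short cylinder vectors: those that are shortest among the cylinder vectors in the
same direction. -/
def shortCylinderVectors : Set (Fin 2 → ℝ) :=
  {v | v ∈ cylinderVectors ∧
    ∀ c : ℝ, 0 < c → c • v ∈ cylinderVectors → 1 ≤ c}

/-- The first quadrant `Σ = {(x, y) : x > 0, y ≥ 0}`. -/
def firstQuadrant : Set (Fin 2 → ℝ) := {v | 0 < v 0 ∧ 0 ≤ v 1}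

/-- The set `Λ` of long saddle connection vectors in the first quadrant. -/
def Lam : Set (Fin 2 → ℝ) := longSaddleConnectionVectors ∩ firstQuadrant

/-- The four matrices `σ₀, σ₁, σ₂, σ₃`. -/
noncomputable def sigma : Fin 4 → Matrix (Fin 2) (Fin 2) ℝ :=
  ![!![1, φ; 0, 1], !![φ, φ; 1, φ], !![φ, 1; φ, φ], !![1, 0; φ, 1]]

/-- The product of a word `k₁ k₂ … kₙ`, in order of application:
`m (k₁ k₂ … kₙ) = σ_{kₙ} ⋯ σ_{k₂} σ_{k₁}`. -/
noncomputable def m : List (Fin 4) → Matrix (Fin 2) (Fin 2) ℝ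
  | [] => 1
  | k :: w => m w * sigma k

end GoldenL

namespace GoldenL

open scoped goldenRatio Matrix
open Filter Topology Set

/-! The proof uses the affine symmetries of the surface and a Euclidean-type descent. The golden L
splits into two horizontal cylinders, of circumference φ and height 1, and of circumference 1 and
height φ - 1 = 1/φ. Both have modulus φ, so the shear by φ makes one full twist in each and fixes
their boundaries. With the reflections in the diagonal and in the horizontal this puts every σᵢ in
the Veech group (`isVeechPair_sigma`). Such matrices permute long saddle connection vectors and
short cylinder vectors alike.

In the positive horizontal direction both notions single out the length 1 (`long_iff_eq_one`,
`short_iff_eq_one`): consecutive singular points on a horizontal line are at distance 1 or φ - 1,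
and closed horizontal orbits have length 1 or φ.

The σᵢ map Σ onto four disjoint sectors that fill Σ, and σᵢ⁻¹ lowers x + y on the part of its sector
off the axis (`exists_sigmaInv_mem`). Only finitely many holonomy vectors in the open quadrant have
bounded x + y (`finite_of_bounded`), so the descent ends on the horizontal axis: every holonomy
vector in Σ is m(w)(c,0) with c > 0 (`exists_word`), and being long or short both mean c = 1.
Quarter turns carry this to the other quadrants. Disjointness of the sectors recovers a word from
its last letter backwards, and the only ambiguity is σ₀e₁ = e₁. -/

theorem one_lt_phi : (1 : ℝ) < φ := Real.one_lt_goldenRatio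

theorem phi_lt_two : φ < 2 := Real.goldenRatio_lt_two

theorem phi_mul_phi : φ * φ = φ + 1 := by
  rw [← sq]; exact Real.goldenRatio_sq

/-! ### Coordinates on the surface and the explicit gluing relation -/

/-- The L-shaped region in coordinates. -/
def InL (x y : ℝ) : Prop :=
  (0 ≤ x ∧ x ≤ φ ∧ 0 ≤ y ∧ y ≤ 1) ∨ (0 ≤ x ∧ x ≤ 1 ∧ 0 ≤ y ∧ y ≤ φ)

/-- The points of the plane that represent the singular point. -/
def Corner (x y : ℝ) : Prop := (x = 0 ∨ x = 1 ∨ x = φ) ∧ (y = 0 ∨ y = 1 ∨ y = φ)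

open Classical in
/-- The point of the surface with given coordinates in the region. -/
noncomputable def pt (x y : ℝ) : Surface :=
  if h : ![x, y] ∈ region then mk ⟨![x, y], h⟩ else singularPoint

theorem mem_region_iff (p : Fin 2 → ℝ) : p ∈ region ↔ InL (p 0) (p 1) := Iff.rfl

theorem mk_eq_pt (p : Fin 2 → ℝ) (h : p ∈ region) : mk ⟨p, h⟩ = pt (p 0) (p 1) := by
  have e : ![p 0, p 1] = p := by ext i; fin_cases i <;> rfl
  have h' : ![p 0, p 1] ∈ region := by rw [e]; exact h
  rw [pt, dif_pos h']
  congr 2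
  exact e.symm

theorem pt_of_inL {x y : ℝ} (h : InL x y) :
    pt x y = mk ⟨![x, y], h⟩ := by
  have h' : ![x, y] ∈ region := h
  rw [pt, dif_pos h']

theorem InL.swap {x y : ℝ} (h : InL x y) : InL y x := by
  unfold InL at *; tauto

theorem pt_glue_left {y : ℝ} (h0 : 0 ≤ y) (h1 : y ≤ 1) : pt 0 y = pt φ y := by
  have := one_lt_phi
  have ha : InL 0 y := Or.inl ⟨le_rfl, by linarith, h0, h1⟩
  have hb : InL φ y := Or.inl ⟨by linarith, le_rfl, h0, h1⟩
  rw [pt_of_inL ha, pt_of_inL hb]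
  exact Quot.sound (Glue.horizontal_long _ _ rfl rfl rfl h1)

theorem pt_glue_left_top {y : ℝ} (h0 : 1 ≤ y) (h1 : y ≤ φ) : pt 0 y = pt 1 y := by
  have := one_lt_phi
  have ha : InL 0 y := Or.inr ⟨le_rfl, by linarith, by linarith, h1⟩
  have hb : InL 1 y := Or.inr ⟨by linarith, le_rfl, by linarith, h1⟩
  rw [pt_of_inL ha, pt_of_inL hb]
  exact Quot.sound (Glue.horizontal_short _ _ rfl rfl rfl h0)

theorem pt_glue_bottom {x : ℝ} (h0 : 0 ≤ x) (h1 : x ≤ 1) : pt x 0 = pt x φ := by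
  have := one_lt_phi
  have ha : InL x 0 := Or.inr ⟨h0, h1, le_rfl, by linarith⟩
  have hb : InL x φ := Or.inr ⟨h0, h1, by linarith, le_rfl⟩
  rw [pt_of_inL ha, pt_of_inL hb]
  exact Quot.sound (Glue.vertical_long _ _ rfl rfl rfl h1)

theorem pt_glue_bottom_right {x : ℝ} (h0 : 1 ≤ x) (h1 : x ≤ φ) : pt x 0 = pt x 1 := by
  have := one_lt_phi
  have ha : InL x 0 := Or.inl ⟨by linarith, h1, by linarith, by linarith⟩
  have hb : InL x 1 := Or.inl ⟨by linarith, h1, by linarith, by linarith⟩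
  rw [pt_of_inL ha, pt_of_inL hb]
  exact Quot.sound (Glue.vertical_short _ _ rfl rfl rfl h0)

theorem singularPoint_eq : singularPoint = pt 0 0 := mk_eq_pt _ _

theorem pt_corner {x y : ℝ} (h : Corner x y) : pt x y = singularPoint := by
  have h1 := one_lt_phi
  have e1 : pt 0 0 = pt φ 0 := pt_glue_left le_rfl zero_le_one
  have e2 : pt 0 1 = pt φ 1 := pt_glue_left zero_le_one le_rfl
  have e3 : pt 0 1 = pt 1 1 := pt_glue_left_top le_rfl h1.le
  have e4 : pt 0 φ = pt 1 φ := pt_glue_left_top h1.le le_rfl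
  have e5 : pt 0 0 = pt 0 φ := pt_glue_bottom le_rfl zero_le_one
  have e6 : pt 1 0 = pt 1 φ := pt_glue_bottom zero_le_one le_rfl
  have e7 : pt 1 0 = pt 1 1 := pt_glue_bottom_right le_rfl h1.le
  -- (φ, φ) satisfies `Corner` but lies outside the region; the default value of `pt` covers it.
  have e8 : pt φ φ = singularPoint := by
    rw [pt, dif_neg]
    rw [mem_region_iff]
    simp only [InL, Matrix.cons_val_zero, Matrix.cons_val_one, not_or]
    constructor <;> intro h <;> linarith [h.1, h.2.1, h.2.2.2]
  rw [singularPoint_eq] at *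
  rcases h with ⟨rfl | rfl | rfl, rfl | rfl | rfl⟩ <;> grind

open Classical in
/-- A canonical representative of the class of a point of the region. -/
noncomputable def canon (x y : ℝ) : ℝ × ℝ :=
  if Corner x y then (0, 0) else
    (if x = φ ∨ (x = 1 ∧ 1 < y) then 0 else x, if y = φ ∨ (y = 1 ∧ 1 < x) then 0 else y)

/-- Being constant on glued pairs, `canon` descends to the quotient and separates classes there,
with no need to follow chains of gluings. -/
theorem canon_glue (p q : region) (h : Glue p q) :
    canon (p.1 0) (p.1 1) = canon (q.1 0) (q.1 1) := by
  have h1 := one_lt_phi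
  have hp := (mem_region_iff _).1 p.2
  have hq := (mem_region_iff _).1 q.2
  rcases h with ⟨a, b, h, hy⟩ | ⟨a, b, h, hy⟩ | ⟨a, b, h, hy⟩ | ⟨a, b, h, hy⟩ <;>
    simp only [canon, Corner, InL] at * <;> grind

/-- Explicit description of the pairs of points of the region with the same image. -/
def Rel (x y x' y' : ℝ) : Prop :=
  (x = x' ∧ y = y') ∨ (Corner x y ∧ Corner x' y') ∨
  (y = y' ∧ 0 < y ∧ y < 1 ∧ (x = 0 ∧ x' = φ ∨ x = φ ∧ x' = 0)) ∨
  (y = y' ∧ 1 < y ∧ y < φ ∧ (x = 0 ∧ x' = 1 ∨ x = 1 ∧ x' = 0)) ∨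
  (x = x' ∧ 0 < x ∧ x < 1 ∧ (y = 0 ∧ y' = φ ∨ y = φ ∧ y' = 0)) ∨
  (x = x' ∧ 1 < x ∧ x < φ ∧ (y = 0 ∧ y' = 1 ∨ y = 1 ∧ y' = 0))

theorem canon_eq_of_pt_eq {x y x' y' : ℝ} (h : InL x y) (h' : InL x' y')
    (e : pt x y = pt x' y') : canon x y = canon x' y' := by
  rw [pt_of_inL h, pt_of_inL h'] at e
  exact congrArg (Quot.lift (fun p : region => canon (p.1 0) (p.1 1)) canon_glue) e

theorem rel_of_pt_eq {x y x' y' : ℝ} (h : InL x y) (h' : InL x' y')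
    (e : pt x y = pt x' y') : Rel x y x' y' := by
  have h1 := one_lt_phi
  have e := canon_eq_of_pt_eq h h' e
  by_cases c : Corner x y <;> by_cases c' : Corner x' y'
  · exact Or.inr (Or.inl ⟨c, c'⟩)
  · exfalso
    simp only [canon, c, c', if_true, if_false, Prod.mk.injEq] at e
    simp only [Corner, InL] at *
    clear c
    grind
  · exfalso
    simp only [canon, c, c', if_true, if_false, Prod.mk.injEq] at e
    simp only [Corner, InL] at *
    clear c'
    grind
  · simp only [canon, c, c', if_false, Prod.mk.injEq] at e
    obtain ⟨e1, e2⟩ := e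
    simp only [Corner, InL, Rel] at *
    split_ifs at e1 e2 <;> grind

theorem corner_of_pt_eq {x y : ℝ} (h : InL x y) (e : pt x y = singularPoint) : Corner x y := by
  have h1 := one_lt_phi
  rw [singularPoint_eq] at e
  have := rel_of_pt_eq h (Or.inl ⟨le_rfl, by linarith, le_rfl, zero_le_one⟩) e
  simp only [Rel, Corner] at *
  grind

/-! ### Straight paths and unique continuation -/

/-- The path `γ` starts as a straight segment with velocity `v` in the region. -/
def Germ (v : Fin 2 → ℝ) (γ : ℝ → Surface) : Prop :=
  ∃ x y, ∀ᶠ s in 𝓝[≥] (0 : ℝ),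
    InL (x + s * v 0) (y + s * v 1) ∧ γ s = pt (x + s * v 0) (y + s * v 1)

theorem eventually_ge_zero_iff {P : ℝ → Prop} :
    (∀ᶠ s in 𝓝[≥] (0 : ℝ), P s) ↔ ∃ ε > 0, ∀ s ∈ Icc (0 : ℝ) ε, P s := by
  change {s | P s} ∈ 𝓝[≥] (0 : ℝ) ↔ _
  rw [mem_nhdsGE_iff_exists_Icc_subset]
  rfl

theorem straightAfter_iff {v : Fin 2 → ℝ} {γ : ℝ → Surface} {t : ℝ} :
    StraightAfter v γ t ↔ Germ v (fun s => γ (t + s)) := by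
  simp only [StraightAfter, Germ, eventually_ge_zero_iff]
  constructor
  · rintro ⟨p, ε, hε, h⟩
    refine ⟨p 0, p 1, ε, hε, fun s hs => ?_⟩
    obtain ⟨h1, h2⟩ := h s hs
    exact ⟨h1, by rw [h2, mk_eq_pt]; rfl⟩
  · rintro ⟨x, y, ε, hε, h⟩
    refine ⟨![x, y], ε, hε, fun s hs => ?_⟩
    obtain ⟨h1, h2⟩ := h s hs
    exact ⟨h1, h2.trans (mk_eq_pt (![x, y] + s • v) h1).symm⟩

/-- Time reversal turns the past with velocity v into a germ with velocity -v, so `Germ` is the only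
local notion needed. -/
theorem straightBefore_iff {v : Fin 2 → ℝ} {γ : ℝ → Surface} {t : ℝ} :
    StraightBefore v γ t ↔ Germ (-v) (fun s => γ (t - s)) := by
  have : StraightBefore v γ t ↔ StraightAfter (-v) (fun s => γ (2 * t - s)) t := by
    simp only [StraightBefore, StraightAfter]
    have (s : ℝ) : 2 * t - (t + s) = t - s := by ring
    simp only [this, smul_neg, ← sub_eq_add_neg]
  rw [this, straightAfter_iff]
  have (s : ℝ) : 2 * t - (t + s) = t - s := by ring
  simp only [this]

/-- The infimum of the failures satisfies `P` by `hleft` (or `h0`), and then `hright` pushes the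
failures away from it. -/
theorem real_induction {P : ℝ → Prop} {T : ℝ} (h0 : P 0)
    (hright : ∀ t ∈ Ico 0 T, P t → ∀ᶠ s in 𝓝[≥] (0 : ℝ), P (t + s))
    (hleft : ∀ t ∈ Ioc 0 T, (∀ s ∈ Ico 0 t, P s) → P t) : ∀ t ∈ Icc 0 T, P t := by
  by_contra! hc
  obtain ⟨t, ht, hPt⟩ := hc
  set B : Set ℝ := {t | t ∈ Icc 0 T ∧ ¬ P t} with hB
  have hne : B.Nonempty := ⟨t, ht, hPt⟩
  have hbd : BddBelow B := ⟨0, fun s hs => hs.1.1⟩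
  have hb0 : 0 ≤ sInf B := le_csInf hne fun s hs => hs.1.1
  have hbT : sInf B ≤ T := (csInf_le hbd ⟨ht, hPt⟩).trans ht.2
  have hlt : ∀ s ∈ Ico 0 (sInf B), P s := by
    intro s hs
    by_contra h
    exact absurd (csInf_le hbd (show s ∈ B from ⟨⟨hs.1, hs.2.le.trans hbT⟩, h⟩)) (not_le.2 hs.2)
  have hPb : P (sInf B) := by
    rcases hb0.eq_or_lt with h | h
    · rw [← h]; exact h0
    · exact hleft _ ⟨h, hbT⟩ hlt
  have hbT' : sInf B < T := by
    refine lt_of_le_of_ne hbT fun h => hPt ?_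
    have : t = sInf B := le_antisymm (h ▸ ht.2) (csInf_le hbd ⟨ht, hPt⟩)
    rw [this]; exact hPb
  obtain ⟨ε, hε, h⟩ := eventually_ge_zero_iff.1 (hright _ ⟨hb0, hbT'⟩ hPb)
  obtain ⟨s, hs, hsε⟩ := exists_lt_of_csInf_lt hne (show sInf B < sInf B + ε by linarith)
  apply hs.2
  have := h (s - sInf B) ⟨by linarith [csInf_le hbd hs], by linarith⟩
  rwa [add_sub_cancel] at this

theorem pt_swap_glue (p q : region) (h : Glue p q) :
    pt (p.1 1) (p.1 0) = pt (q.1 1) (q.1 0) := by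
  have h1 := one_lt_phi
  have hpL := (mem_region_iff _).1 p.2
  have hqL := (mem_region_iff _).1 q.2
  rcases h with ⟨hp, hq, h, hy⟩ | ⟨hp, hq, h, hy⟩ | ⟨hp, hq, h, hy⟩ | ⟨hp, hq, h, hy⟩ <;>
    rw [hp, hq, ← h] <;> simp only [InL] at hpL hqL
  · exact pt_glue_bottom (by grind) hy
  · exact pt_glue_bottom_right hy (by grind)
  · exact pt_glue_left (by grind) hy
  · exact pt_glue_left_top hy (by grind)

/-- The action of the reflection in the diagonal on the surface. -/
noncomputable def swapMap : Surface → Surface :=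
  Quot.lift (fun p : region => pt (p.1 1) (p.1 0)) pt_swap_glue

theorem swapMap_pt {x y : ℝ} (h : InL x y) : swapMap (pt x y) = pt y x := by
  rw [pt_of_inL h]; rfl

theorem pt_swap_eq {x y x' y' : ℝ} (h : InL x y) (h' : InL x' y') (e : pt x y = pt x' y') :
    pt y x = pt y' x' := by
  rw [← swapMap_pt h, ← swapMap_pt h', e]

theorem pt_swap_ne {x y : ℝ} (h : InL x y) (e : pt x y ≠ singularPoint) :
    pt y x ≠ singularPoint := fun e' => e <|
  pt_corner (corner_of_pt_eq h.swap e').symm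

/-- Two segments in the region that start at points glued along a vertical side end at
points with the same image. -/
theorem pt_eq_of_vertical_sides {y y' a u w s : ℝ} (hs : 0 < s)
    (ha : (a = φ ∧ 0 < y ∧ y < 1) ∨ (a = 1 ∧ 1 < y ∧ y < φ)) (hy : y = y')
    (h1 : ∀ t ∈ Icc 0 s, InL (0 + t * u) (y + t * w))
    (h2 : ∀ t ∈ Icc 0 s, InL (a + t * u) (y' + t * w))
    (hn : ∀ t ∈ Ico 0 s, pt (0 + t * u) (y + t * w) ≠ singularPoint ∨
      pt (a + t * u) (y' + t * w) ≠ singularPoint) :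
    pt (0 + s * u) (y + s * w) = pt (a + s * u) (y' + s * w) := by
  subst hy
  have hφ := one_lt_phi
  have hu : 0 ≤ u := by
    have := h1 s ⟨hs.le, le_rfl⟩
    have : 0 ≤ s * u := by simp only [InL] at this; grind
    exact nonneg_of_mul_nonneg_right this hs
  have hsu : 0 ≤ s * u := mul_nonneg hs.le hu
  have hE := h2 s ⟨hs.le, le_rfl⟩
  have hE1 := h1 s ⟨hs.le, le_rfl⟩
  rcases ha with ⟨rfl, hy0, hy1⟩ | ⟨rfl, hy0, hy1⟩
  -- Neither segment can leave the strip 0 ≤ x ≤ φ, so both run along their sides.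
  · have : s * u = 0 := by simp only [InL] at hE; grind
    simp only [this, zero_add, add_zero] at *
    exact pt_glue_left (by simp only [InL] at hE; grind) (by simp only [InL] at hE; grind)
  · have hu0 : u = 0 := by
      by_contra hne
      have hu : 0 < u := lt_of_le_of_ne hu (Ne.symm hne)
      obtain ⟨t, ht0, hts, htw⟩ : ∃ t, 0 < t ∧ t ≤ s ∧ 1 < y + t * w := by
        have hc : ContinuousAt (fun t : ℝ => y + t * w) 0 := by fun_prop
        have h' : ∀ᶠ t in 𝓝[>] (0 : ℝ), 1 < y + t * w :=
          (hc.eventually (lt_mem_nhds (by simpa using hy0))).filter_mono nhdsWithin_le_nhds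
        obtain ⟨t, h3, h4⟩ := (h'.and (Ioc_mem_nhdsGT hs)).exists
        exact ⟨t, h4.1, h4.2, h3⟩
      have := h2 t ⟨ht0.le, hts⟩
      have : 0 < t * u := mul_pos ht0 hu
      simp only [InL] at *; grind
    subst hu0
    simp only [mul_zero, add_zero] at *
    refine pt_glue_left_top ?_ (by simp only [InL] at hE1; grind)
    -- Going below height 1 along the two short sides would pass through the corners (0,1) and
    -- (1,1), at time (1 - y)/w.
    by_contra hlt
    rw [not_le] at hlt
    have hw : w < 0 := by
      by_contra hw
      have := mul_nonneg hs.le (not_lt.1 hw)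
      linarith
    have h1w : (1 - y) / w * w = 1 - y := div_mul_cancel₀ _ hw.ne
    have hmem : (1 - y) / w ∈ Ico 0 s :=
      ⟨div_nonneg_of_nonpos (by linarith) hw.le, by rw [div_lt_iff_of_neg hw]; linarith⟩
    have hy1 : y + (1 - y) / w * w = 1 := by rw [h1w]; ring
    have hc := hn _ hmem
    rw [hy1] at hc
    rcases hc with hc | hc
    · exact hc (pt_corner ⟨Or.inl rfl, Or.inr (Or.inl rfl)⟩)
    · exact hc (pt_corner ⟨Or.inr (Or.inl rfl), Or.inr (Or.inl rfl)⟩)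

/-- Two segments in the region with the same image at the beginning, which avoid the singular
point, have the same image at the end. -/
theorem pt_eq_of_segments {x y x' y' u w s : ℝ} (hs : 0 ≤ s)
    (h1 : ∀ t ∈ Icc 0 s, InL (x + t * u) (y + t * w))
    (h2 : ∀ t ∈ Icc 0 s, InL (x' + t * u) (y' + t * w))
    (he : pt x y = pt x' y')
    (hn : ∀ t ∈ Ico 0 s, pt (x + t * u) (y + t * w) ≠ singularPoint) :
    pt (x + s * u) (y + s * w) = pt (x' + s * u) (y' + s * w) := by
  rcases hs.eq_or_lt with rfl | hs
  · simpa using he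
  have hL : InL x y := by simpa using h1 0 ⟨le_rfl, hs.le⟩
  have hL' : InL x' y' := by simpa using h2 0 ⟨le_rfl, hs.le⟩
  have h1s := fun t ht => (h1 t ht).swap
  have h2s := fun t ht => (h2 t ht).swap
  have hns := fun t ht => pt_swap_ne (h1 t (Ico_subset_Icc_self ht)) (hn t ht)
  have hE := h1s s ⟨hs.le, le_rfl⟩
  have hE' := h2s s ⟨hs.le, le_rfl⟩
  rcases rel_of_pt_eq hL hL' he with ⟨rfl, rfl⟩ | ⟨hc, -⟩ | ⟨e, a, b, ⟨rfl, rfl⟩ | ⟨rfl, rfl⟩⟩ |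
    ⟨e, a, b, ⟨rfl, rfl⟩ | ⟨rfl, rfl⟩⟩ | ⟨e, a, b, ⟨rfl, rfl⟩ | ⟨rfl, rfl⟩⟩ |
    ⟨e, a, b, ⟨rfl, rfl⟩ | ⟨rfl, rfl⟩⟩
  · rfl
  · exact absurd (pt_corner hc) (by simpa using hn 0 ⟨le_rfl, hs⟩)
  · exact pt_eq_of_vertical_sides hs (Or.inl ⟨rfl, a, b⟩) e h1 h2 fun t ht => Or.inl (hn t ht)
  · exact (pt_eq_of_vertical_sides hs (Or.inl ⟨rfl, e ▸ a, e ▸ b⟩) e.symm h2 h1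
      fun t ht => Or.inr (hn t ht)).symm
  · exact pt_eq_of_vertical_sides hs (Or.inr ⟨rfl, a, b⟩) e h1 h2 fun t ht => Or.inl (hn t ht)
  · exact (pt_eq_of_vertical_sides hs (Or.inr ⟨rfl, e ▸ a, e ▸ b⟩) e.symm h2 h1
      fun t ht => Or.inr (hn t ht)).symm
  -- Horizontal sides reduce to vertical ones by the reflection in the diagonal.
  · exact pt_swap_eq hE hE'
      (pt_eq_of_vertical_sides hs (Or.inl ⟨rfl, a, b⟩) e h1s h2s
        fun t ht => Or.inl (hns t ht))
  · exact pt_swap_eq hE hE'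
      (pt_eq_of_vertical_sides hs (Or.inl ⟨rfl, e ▸ a, e ▸ b⟩) e.symm h2s h1s
        fun t ht => Or.inr (hns t ht)).symm
  · exact pt_swap_eq hE hE'
      (pt_eq_of_vertical_sides hs (Or.inr ⟨rfl, a, b⟩) e h1s h2s
        fun t ht => Or.inl (hns t ht))
  · exact pt_swap_eq hE hE'
      (pt_eq_of_vertical_sides hs (Or.inr ⟨rfl, e ▸ a, e ▸ b⟩) e.symm h2s h1s
        fun t ht => Or.inr (hns t ht)).symm

/-- Straight paths with the same velocity that avoid the singular point and agree at first
agree throughout. -/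
theorem straight_unique {v : Fin 2 → ℝ} {γ δ : ℝ → Surface} {T : ℝ}
    (ha : ∀ t ∈ Ioo 0 T, StraightAfter v γ t) (hb : ∀ t ∈ Ioc 0 T, StraightBefore v γ t)
    (ha' : ∀ t ∈ Ioo 0 T, StraightAfter v δ t) (hb' : ∀ t ∈ Ioc 0 T, StraightBefore v δ t)
    (hn : ∀ t ∈ Ioo 0 T, γ t ≠ singularPoint)
    (h0 : ∀ᶠ s in 𝓝[≥] (0 : ℝ), γ s = δ s) : ∀ t ∈ Icc 0 T, γ t = δ t := by
  refine real_induction (by simpa using h0.self_of_nhdsWithin (mem_Ici.2 le_rfl)) ?_ ?_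
  · intro t ht he
    -- At time 0 the path may be at the cone point, where equality of position does not determine
    -- the germ; this is why `h0` assumes agreement on a whole germ.
    rcases ht.1.eq_or_lt with rfl | h_pos
    · simpa using h0
    obtain ⟨x, y, h1⟩ := straightAfter_iff.1 (ha t ⟨h_pos, ht.2⟩)
    obtain ⟨x', y', h2⟩ := straightAfter_iff.1 (ha' t ⟨h_pos, ht.2⟩)
    beta_reduce at h1 h2
    have h3 : ∀ᶠ s in 𝓝[≥] (0 : ℝ), t + s < T := by
      have hc : ContinuousAt (fun s : ℝ => t + s) 0 := by fun_prop
      exact (hc.eventually (gt_mem_nhds (by simpa using ht.2))).filter_mono nhdsWithin_le_nhds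
    have e0 : pt x y = pt x' y' := by
      have a := (h1.self_of_nhdsWithin (mem_Ici.2 le_rfl)).2
      have b := (h2.self_of_nhdsWithin (mem_Ici.2 le_rfl)).2
      simp only [add_zero, zero_mul] at a b
      rw [← a, ← b, he]
    obtain ⟨ε, hε, h⟩ := eventually_ge_zero_iff.1 (h1.and (h2.and h3))
    refine eventually_ge_zero_iff.2 ⟨ε, hε, fun s hs => ?_⟩
    rw [(h s hs).1.2, (h s hs).2.1.2]
    refine pt_eq_of_segments hs.1 (fun r hr => (h r ⟨hr.1, hr.2.trans hs.2⟩).1.1)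
      (fun r hr => (h r ⟨hr.1, hr.2.trans hs.2⟩).2.1.1) e0 fun r hr => ?_
    have hr' := h r ⟨hr.1, hr.2.le.trans hs.2⟩
    rw [← hr'.1.2]
    exact hn _ ⟨add_pos_of_pos_of_nonneg h_pos hr.1, hr'.2.2⟩
  · intro t ht he
    obtain ⟨x, y, h1⟩ := straightBefore_iff.1 (hb t ht)
    obtain ⟨x', y', h2⟩ := straightBefore_iff.1 (hb' t ht)
    obtain ⟨ε, hε, h⟩ := eventually_ge_zero_iff.1 (h1.and h2)
    set s := min ε (t / 2) with hs
    have hs0 : 0 < s := lt_min hε (half_pos ht.1)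
    have hst : s < t := (min_le_right _ _).trans_lt (half_lt_self ht.1)
    have hsε : s ≤ ε := min_le_left _ _
    simp only [Pi.neg_apply] at h
    have a1 (r a b : ℝ) : a + s * -b + r * b = a + (s - r) * -b := by ring
    have key := pt_eq_of_segments (x := x + s * -v 0) (y := y + s * -v 1)
      (x' := x' + s * -v 0) (y' := y' + s * -v 1) (u := v 0) (w := v 1) hs0.le
      (fun r hr => by
        simp only [a1]
        exact (h (s - r) ⟨by linarith [hr.2], by linarith [hr.1]⟩).1.1)
      (fun r hr => by
        simp only [a1]
        exact (h (s - r) ⟨by linarith [hr.2], by linarith [hr.1]⟩).2.1)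
      (by
        have := h s ⟨hs0.le, hsε⟩
        rw [← this.1.2, ← this.2.2]
        exact he _ ⟨by linarith, by linarith⟩)
      (fun r hr => by
        simp only [a1]
        rw [← (h (s - r) ⟨by linarith [hr.2], by linarith [hr.1]⟩).1.2]
        exact hn _ ⟨by linarith [hr.1], by linarith [hr.1, hr.2, ht.2]⟩)
    simp only [a1, sub_self] at key
    have := h 0 ⟨le_rfl, hε.le⟩
    rw [← this.1.2, ← this.2.2, sub_zero] at key
    exact key

theorem eventually_le_or_gt (a b : ℝ) :
    (∀ᶠ s in 𝓝[≥] (0 : ℝ), a + s * b ≤ 0) ∨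
      ∀ᶠ s in 𝓝[≥] (0 : ℝ), 0 ≤ a + s * b ∧ (0 < s → 0 < a + s * b) := by
  have hc : ContinuousAt (fun s : ℝ => a + s * b) 0 := by fun_prop
  rcases lt_trichotomy a 0 with h | rfl | h
  · left
    exact ((hc.eventually (gt_mem_nhds (by simpa using h))).filter_mono nhdsWithin_le_nhds).mono
      fun _ h => le_of_lt h
  · rcases le_or_gt b 0 with h | h
    · left
      filter_upwards [self_mem_nhdsWithin] with s hs
      simpa using mul_nonpos_of_nonneg_of_nonpos hs h
    · right
      filter_upwards [self_mem_nhdsWithin] with s hs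
      simp only [zero_add]
      exact ⟨mul_nonneg hs h.le, fun hs' => mul_pos hs' h⟩
  · right
    exact ((hc.eventually (lt_mem_nhds (by simpa using h))).filter_mono nhdsWithin_le_nhds).mono
      fun _ h => ⟨le_of_lt h, fun _ => h⟩

theorem eventually_le_or_ge (a b : ℝ) :
    (∀ᶠ s in 𝓝[≥] (0 : ℝ), a + s * b ≤ 0) ∨ ∀ᶠ s in 𝓝[≥] (0 : ℝ), 0 ≤ a + s * b :=
  (eventually_le_or_gt a b).imp_right fun h => h.mono fun _ h => h.1

/-- A segment in the region starts in one of its two horizontal cylinders. -/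
theorem eventually_bottom_or_top {x y u w : ℝ}
    (h : ∀ᶠ s in 𝓝[≥] (0 : ℝ), InL (x + s * u) (y + s * w)) :
    (∀ᶠ s in 𝓝[≥] (0 : ℝ), 0 ≤ x + s * u ∧ x + s * u ≤ φ ∧ 0 ≤ y + s * w ∧ y + s * w ≤ 1) ∨
    ∀ᶠ s in 𝓝[≥] (0 : ℝ), 0 ≤ x + s * u ∧ x + s * u ≤ 1 ∧ 1 ≤ y + s * w ∧ y + s * w ≤ φ := by
  have h1 := one_lt_phi
  rcases eventually_le_or_gt (y - 1) w with hy | hy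
  · left
    filter_upwards [h, hy] with s hs hs'
    simp only [InL] at hs
    clear h hy
    grind
  rcases eventually_le_or_gt (x - 1) u with hx | hx
  · right
    filter_upwards [h, hx, hy] with s hs hs' hs''
    simp only [InL] at hs
    clear h hy hx
    grind
  -- Otherwise both coordinates exceed 1 for small s > 0, which leaves the region.
  obtain ⟨ε, hε, hall⟩ := eventually_ge_zero_iff.1 (h.and (hx.and hy))
  obtain ⟨h3, h4, h5⟩ := hall ε ⟨hε.le, le_rfl⟩
  have h4 := h4.2 hε
  have h5 := h5.2 hε
  simp only [InL] at h3
  grind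

/-! ### Affine automorphisms -/

/-- `F` is an affine automorphism of the golden L with linear part `A`. -/
structure IsAut (A : Matrix (Fin 2) (Fin 2) ℝ) (F : Surface → Surface) : Prop where
  ne_zero : ∀ v, v ≠ 0 → A.mulVec v ≠ 0
  inj : Function.Injective F
  singular : F singularPoint = singularPoint
  germ : ∀ v γ, Germ v γ → Germ (A.mulVec v) (F ∘ γ)

theorem IsAut.one : IsAut 1 id where
  ne_zero v h := by simpa using h
  inj := Function.injective_id
  singular := rfl
  germ v γ h := by simpa using h

theorem IsAut.mul {A B : Matrix (Fin 2) (Fin 2) ℝ} {F G : Surface → Surface}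
    (hA : IsAut A F) (hB : IsAut B G) : IsAut (A * B) (F ∘ G) where
  ne_zero v h := by
    rw [← Matrix.mulVec_mulVec]
    exact hA.ne_zero _ (hB.ne_zero _ h)
  inj := hA.inj.comp hB.inj
  singular := by rw [Function.comp_apply, hB.singular, hA.singular]
  germ v γ h := by
    rw [← Matrix.mulVec_mulVec]
    exact hA.germ _ _ (hB.germ _ _ h)

theorem IsAut.ne_singular {A : Matrix (Fin 2) (Fin 2) ℝ} {F : Surface → Surface}
    (hA : IsAut A F) {x : Surface} (h : x ≠ singularPoint) : F x ≠ singularPoint := by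
  rw [← hA.singular]
  exact hA.inj.ne h

theorem IsAut.straightAfter {A : Matrix (Fin 2) (Fin 2) ℝ} {F : Surface → Surface}
    (hA : IsAut A F) {v γ t} (h : StraightAfter v γ t) :
    StraightAfter (A.mulVec v) (F ∘ γ) t := by
  rw [straightAfter_iff] at *
  exact hA.germ _ _ h

theorem IsAut.straightBefore {A : Matrix (Fin 2) (Fin 2) ℝ} {F : Surface → Surface}
    (hA : IsAut A F) {v γ t} (h : StraightBefore v γ t) :
    StraightBefore (A.mulVec v) (F ∘ γ) t := by
  rw [straightBefore_iff] at *
  rw [← Matrix.mulVec_neg]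
  exact hA.germ _ _ h

theorem IsAut.saddleConnection {A : Matrix (Fin 2) (Fin 2) ℝ} {F : Surface → Surface}
    (hA : IsAut A F) {v : Fin 2 → ℝ} (h : v ∈ saddleConnectionVectors) :
    A.mulVec v ∈ saddleConnectionVectors := by
  obtain ⟨h0, γ, h1, h2, h3, h4, h5⟩ := h
  refine ⟨hA.ne_zero v h0, F ∘ γ, ?_, ?_, fun t ht => hA.ne_singular (h3 t ht),
    fun t ht => hA.straightAfter (h4 t ht), fun t ht => hA.straightBefore (h5 t ht)⟩
  · rw [Function.comp_apply, h1, hA.singular]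
  · rw [Function.comp_apply, h2, hA.singular]

theorem IsAut.cylinder {A : Matrix (Fin 2) (Fin 2) ℝ} {F : Surface → Surface}
    (hA : IsAut A F) {v : Fin 2 → ℝ} (h : v ∈ cylinderVectors) :
    A.mulVec v ∈ cylinderVectors := by
  obtain ⟨h0, γ, h1, h2, h3, h4, h5⟩ := h
  exact ⟨hA.ne_zero v h0, F ∘ γ, fun t => hA.ne_singular (h1 t),
    fun t => hA.straightAfter (h2 t), fun t => hA.straightBefore (h3 t), h4.comp F,
    fun s hs hp => h5 s hs fun t => hA.inj (hp t)⟩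

/-- A criterion for involutions of the surface to be affine automorphisms. -/
theorem IsAut.of_involution {a b c d : ℝ} {F : Surface → Surface}
    (hd : a * d - b * c ≠ 0)
    (hinv : ∀ x y, InL x y → F (F (pt x y)) = pt x y)
    (hs : F singularPoint = singularPoint)
    (hg : ∀ x y u w : ℝ, (∀ᶠ s in 𝓝[≥] (0 : ℝ), InL (x + s * u) (y + s * w)) →
      ∃ e f : ℝ, ∀ᶠ s in 𝓝[≥] (0 : ℝ),
        let X := a * (x + s * u) + b * (y + s * w) + e
        let Y := c * (x + s * u) + d * (y + s * w) + f
        InL X Y ∧ F (pt (x + s * u) (y + s * w)) = pt X Y) :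
    IsAut !![a, b; c, d] F where
  ne_zero v hv h := by
    have h0 : a * v 0 + b * v 1 = 0 := by
      simpa [Matrix.mulVec, dotProduct, Fin.sum_univ_two] using congrFun h 0
    have h1 : c * v 0 + d * v 1 = 0 := by
      simpa [Matrix.mulVec, dotProduct, Fin.sum_univ_two] using congrFun h 1
    apply hv
    ext i
    fin_cases i
    · exact (mul_eq_zero.1 (show (a * d - b * c) * v 0 = 0 by
        linear_combination d * h0 - b * h1)).resolve_left hd
    · exact (mul_eq_zero.1 (show (a * d - b * c) * v 1 = 0 by
        linear_combination a * h1 - c * h0)).resolve_left hd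
  inj := by
    have : Function.LeftInverse F F := by
      rintro ⟨p⟩
      have : Quot.mk Glue p = pt (p.1 0) (p.1 1) := mk_eq_pt p.1 p.2
      rw [this]
      exact hinv _ _ p.2
    exact this.injective
  singular := hs
  germ v γ := by
    rintro ⟨x, y, h⟩
    -- The translation part may depend on the germ; only the linear part is global.
    obtain ⟨e, f, h'⟩ := hg x y (v 0) (v 1) (h.mono fun _ h => h.1)
    refine ⟨a * x + b * y + e, c * x + d * y + f, ?_⟩
    filter_upwards [h, h'] with s hs hs'
    have e0 : (!![a, b; c, d].mulVec v) 0 = a * v 0 + b * v 1 := by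
      simp [Matrix.mulVec, dotProduct, Fin.sum_univ_two]
    have e1 : (!![a, b; c, d].mulVec v) 1 = c * v 0 + d * v 1 := by
      simp [Matrix.mulVec, dotProduct, Fin.sum_univ_two]
    have e2 : a * x + b * y + e + s * (!![a, b; c, d].mulVec v) 0
      = a * (x + s * v 0) + b * (y + s * v 1) + e := by rw [e0]; ring
    have e3 : c * x + d * y + f + s * (!![a, b; c, d].mulVec v) 1
      = c * (x + s * v 0) + d * (y + s * v 1) + f := by rw [e1]; ring
    rw [e2, e3, Function.comp_apply, hs.2]
    exact hs'

/-! ### Three reflections of the golden L -/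

theorem isAut_swap : IsAut !![0, 1; 1, 0] swapMap := by
  refine IsAut.of_involution (by norm_num) (fun x y h => ?_) ?_ fun x y u w h => ?_
  · rw [swapMap_pt h, swapMap_pt h.swap]
  · have := one_lt_phi
    rw [singularPoint_eq, swapMap_pt (Or.inl ⟨le_rfl, by linarith, le_rfl, zero_le_one⟩)]
  · refine ⟨0, 0, h.mono fun s hs => ?_⟩
    simp only [zero_mul, one_mul, zero_add, add_zero]
    exact ⟨hs.swap, swapMap_pt hs⟩

/-- The reflection of both horizontal cylinders in horizontal lines, in coordinates. -/
noncomputable def flipPt (x y : ℝ) : Surface :=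
  if y ≤ 1 then pt x (1 - y) else pt x (1 + φ - y)

theorem flipPt_bottom {x y : ℝ} (h1 : y ≤ 1) : flipPt x y = pt x (1 - y) := if_pos h1

/-- The definition uses the lower branch at y = 1; the upper formula agrees there because [0,1] ×
{0} is glued to [0,1] × {φ}. -/
theorem flipPt_top {x y : ℝ} (hx : 0 ≤ x) (hx1 : x ≤ 1) (h1 : 1 ≤ y) :
    flipPt x y = pt x (1 + φ - y) := by
  rcases h1.eq_or_lt with rfl | h
  · rw [flipPt_bottom le_rfl, sub_self, add_sub_cancel_left, pt_glue_bottom hx hx1]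
  · exact if_neg (not_le.2 h)

theorem flipPt_glue (p q : region) (h : Glue p q) :
    flipPt (p.1 0) (p.1 1) = flipPt (q.1 0) (q.1 1) := by
  have h1 := one_lt_phi
  have hpL := (mem_region_iff _).1 p.2
  have hqL := (mem_region_iff _).1 q.2
  rcases h with ⟨hp, hq, h, hy⟩ | ⟨hp, hq, h, hy⟩ | ⟨hp, hq, h, hy⟩ | ⟨hp, hq, h, hy⟩ <;>
    rw [hp, hq, ← h] <;> simp only [InL] at hpL hqL
  · rw [flipPt_bottom hy, flipPt_bottom hy, pt_glue_left (by linarith) (by grind)]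
  · rw [flipPt_top le_rfl zero_le_one hy, flipPt_top zero_le_one le_rfl hy,
      pt_glue_left_top (by grind) (by linarith)]
  · rw [flipPt_bottom zero_le_one, flipPt_top (by grind) hy h1.le]
    congr 1; ring
  · rw [flipPt_bottom zero_le_one, flipPt_bottom le_rfl, sub_self, sub_zero,
      pt_glue_bottom_right hy (by grind)]

/-- The reflection of both horizontal cylinders in horizontal lines. -/
noncomputable def flipMap : Surface → Surface :=
  Quot.lift (fun p : region => flipPt (p.1 0) (p.1 1)) flipPt_glue

theorem flipMap_pt {x y : ℝ} (h : InL x y) : flipMap (pt x y) = flipPt x y := by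
  rw [pt_of_inL h]; rfl

theorem isAut_flip : IsAut !![1, 0; 0, -1] flipMap := by
  have h1 := one_lt_phi
  refine IsAut.of_involution (by norm_num) (fun x y h => ?_) ?_ fun x y u w h => ?_
  · rw [flipMap_pt h]
    rcases le_or_gt y 1 with hy | hy
    · rw [flipPt_bottom hy, flipMap_pt (by simp only [InL] at *; grind),
        flipPt_bottom (by simp only [InL] at *; grind)]
      congr 1; ring
    · have : 0 ≤ x ∧ x ≤ 1 := by simp only [InL] at *; grind
      rw [flipPt_top this.1 this.2 hy.le, flipMap_pt (by simp only [InL] at *; grind),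
        flipPt_top this.1 this.2 (by simp only [InL] at *; grind)]
      congr 1; ring
  · rw [singularPoint_eq, flipMap_pt (Or.inl ⟨le_rfl, by linarith, le_rfl, zero_le_one⟩),
      flipPt_bottom zero_le_one, ← singularPoint_eq]
    exact pt_corner ⟨Or.inl rfl, Or.inr (Or.inl (by ring))⟩
  · simp only [zero_mul, one_mul, zero_add, add_zero]
    rcases eventually_bottom_or_top h with h' | h'
    · refine ⟨0, 1, ?_⟩
      filter_upwards [h, h'] with s hs hs'
      rw [flipMap_pt hs, flipPt_bottom hs'.2.2.2]
      refine ⟨Or.inl ⟨?_, ?_, ?_, ?_⟩, ?_⟩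
      any_goals linarith
      congr 1 <;> ring
    · refine ⟨0, 1 + φ, ?_⟩
      filter_upwards [h, h'] with s hs hs'
      rw [flipMap_pt hs, flipPt_top hs'.1 hs'.2.1 hs'.2.2.1]
      refine ⟨Or.inr ⟨?_, ?_, ?_, ?_⟩, ?_⟩
      any_goals linarith
      congr 1 <;> ring

/-- The map `(x, y) ↦ (x + φ y, -y)`, up to translations in the two horizontal cylinders,
in coordinates. -/
noncomputable def shearFlipPt (x y : ℝ) : Surface :=
  if y ≤ 1 then
    if x + φ * y ≤ φ then pt (x + φ * y) (1 - y) else pt (x + φ * y - φ) (1 - y)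
  else
    if x + φ * (y - 1) ≤ 1 then pt (x + φ * (y - 1)) (1 + φ - y)
    else pt (x + φ * (y - 1) - 1) (1 + φ - y)

theorem shearFlipPt_bottom_left {x y : ℝ} (hy : y ≤ 1) (h : x + φ * y ≤ φ) :
    shearFlipPt x y = pt (x + φ * y) (1 - y) := by
  rw [shearFlipPt, if_pos hy, if_pos h]

theorem shearFlipPt_bottom_right {x y : ℝ} (hy0 : 0 ≤ y) (hy : y ≤ 1) (h : φ ≤ x + φ * y) :
    shearFlipPt x y = pt (x + φ * y - φ) (1 - y) := by
  rcases h.eq_or_lt with h | h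
  · rw [shearFlipPt_bottom_left hy h.ge, ← h, sub_self,
      pt_glue_left (by linarith) (by linarith)]
  · rw [shearFlipPt, if_pos hy, if_neg (not_le.2 h)]

theorem shearFlipPt_top_left {x y : ℝ} (hx0 : 0 ≤ x) (hy : 1 ≤ y) (h : x + φ * (y - 1) ≤ 1) :
    shearFlipPt x y = pt (x + φ * (y - 1)) (1 + φ - y) := by
  rcases hy.eq_or_lt with rfl | hy
  · rw [shearFlipPt_bottom_right zero_le_one le_rfl (by linarith)]
    have hx : x ≤ 1 := by linarith
    simp only [sub_self, mul_zero, add_zero, mul_one, add_sub_cancel_right, add_sub_cancel_left]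
    exact pt_glue_bottom hx0 hx
  · rw [shearFlipPt, if_neg (not_le.2 hy), if_pos h]

theorem shearFlipPt_top_right {x y : ℝ} (hx1 : x ≤ 1) (hy : 1 ≤ y) (hy1 : y ≤ φ)
    (h : 1 ≤ x + φ * (y - 1)) :
    shearFlipPt x y = pt (x + φ * (y - 1) - 1) (1 + φ - y) := by
  have h1 := one_lt_phi
  rcases h.eq_or_lt with h | h
  · rw [shearFlipPt_top_left _ hy h.ge, ← h, sub_self,
      pt_glue_left_top (by linarith) (by linarith)]
    nlinarith [phi_mul_phi]
  · have : 1 < y := by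
      refine lt_of_le_of_ne hy ?_
      rintro rfl
      linarith
    rw [shearFlipPt, if_neg (not_le.2 this), if_neg (not_le.2 h)]

theorem shearFlipPt_glue (p q : region) (h : Glue p q) :
    shearFlipPt (p.1 0) (p.1 1) = shearFlipPt (q.1 0) (q.1 1) := by
  have h1 := one_lt_phi
  have h2 := phi_mul_phi
  have hpL := (mem_region_iff _).1 p.2
  have hqL := (mem_region_iff _).1 q.2
  rcases h with ⟨hp, hq, h, hy⟩ | ⟨hp, hq, h, hy⟩ | ⟨hp, hq, h, hy⟩ | ⟨hp, hq, h, hy⟩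
  · rw [hp, hq, ← h]
    have hy0 : 0 ≤ p.1 1 := by simp only [InL] at hpL; grind
    have h3 := mul_le_mul_of_nonneg_left hy (by linarith : 0 ≤ φ)
    have h4 := mul_nonneg (by linarith : 0 ≤ φ) hy0
    rw [shearFlipPt_bottom_left hy (by linarith), shearFlipPt_bottom_right hy0 hy (by linarith)]
    congr 1; ring
  · rw [hp, hq, ← h]
    have hy1 : p.1 1 ≤ φ := by simp only [InL] at hpL; grind
    have h3 := mul_le_mul_of_nonneg_left hy1 (by linarith : 0 ≤ φ)
    have h4 := mul_le_mul_of_nonneg_left hy (by linarith : 0 ≤ φ)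
    rw [shearFlipPt_top_left le_rfl hy (by linarith),
      shearFlipPt_top_right le_rfl hy hy1 (by linarith)]
    congr 1; ring
  · rw [hp, hq, ← h]
    have hx0 : 0 ≤ p.1 0 := by simp only [InL] at hpL; grind
    rw [shearFlipPt_bottom_left zero_le_one (by linarith),
      shearFlipPt_top_right hy h1.le le_rfl (by linarith)]
    congr 1
    -- φ(φ - 1) = 1: the top of the upper cylinder moves by exactly one circumference.
    · linear_combination -h2
    · ring
  · rw [hp, hq, ← h]
    have hx1 : p.1 0 ≤ φ := by simp only [InL] at hpL; grind
    rw [shearFlipPt_bottom_left zero_le_one (by linarith),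
      shearFlipPt_bottom_right zero_le_one le_rfl (by linarith)]
    simp only [mul_zero, add_zero, sub_zero, mul_one, add_sub_cancel_right, sub_self]
    exact (pt_glue_bottom_right hy hx1).symm

/-- The automorphism `(x, y) ↦ (x + φ y, -y)`, up to translations in the two horizontal
cylinders. -/
noncomputable def shearFlipMap : Surface → Surface :=
  Quot.lift (fun p : region => shearFlipPt (p.1 0) (p.1 1)) shearFlipPt_glue

theorem shearFlipMap_pt {x y : ℝ} (h : InL x y) : shearFlipMap (pt x y) = shearFlipPt x y := by
  rw [pt_of_inL h]; rfl

theorem shearFlipMap_shearFlipMap {x y : ℝ} (h : InL x y) :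
    shearFlipMap (shearFlipMap (pt x y)) = pt x y := by
  have h1 := one_lt_phi
  have h2 := phi_mul_phi
  have h0 : 0 ≤ φ := by linarith
  rw [shearFlipMap_pt h]
  rcases le_or_gt y 1 with hy | hy
  · have hy0 : 0 ≤ y := by simp only [InL] at h; grind
    have hx0 : 0 ≤ x := by simp only [InL] at h; grind
    have hx1 : x ≤ φ := by simp only [InL] at h; grind
    have h3 := mul_le_mul_of_nonneg_left hy h0
    have h4 := mul_nonneg h0 hy0
    rcases le_total (x + φ * y) φ with h5 | h5
    · rw [shearFlipPt_bottom_left hy h5,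
        shearFlipMap_pt (Or.inl ⟨by linarith, h5, by linarith, by linarith⟩),
        shearFlipPt_bottom_right (by linarith) (by linarith) (by linarith)]
      congr 1 <;> ring
    · rw [shearFlipPt_bottom_right hy0 hy h5,
        shearFlipMap_pt (Or.inl ⟨by linarith, by linarith, by linarith, by linarith⟩),
        shearFlipPt_bottom_left (by linarith) (by linarith)]
      congr 1 <;> ring
  · have hy1 : y ≤ φ := by simp only [InL] at h; grind
    have hx0 : 0 ≤ x := by simp only [InL] at h; grind
    have hx1 : x ≤ 1 := by simp only [InL] at h; grind
    have h3 := mul_le_mul_of_nonneg_left hy1 h0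
    have h4 := mul_le_mul_of_nonneg_left hy.le h0
    rcases le_total (x + φ * (y - 1)) 1 with h5 | h5
    · rw [shearFlipPt_top_left hx0 hy.le h5,
        shearFlipMap_pt (Or.inr ⟨by linarith, h5, by linarith, by linarith⟩),
        shearFlipPt_top_right (by linarith) (by linarith) (by linarith) (by linarith)]
      congr 1
      · linear_combination h2
      · ring
    · rw [shearFlipPt_top_right hx1 hy.le hy1 h5,
        shearFlipMap_pt (Or.inr ⟨by linarith, by linarith, by linarith, by linarith⟩),
        shearFlipPt_top_left (by linarith) (by linarith) (by linarith)]
      congr 1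
      · linear_combination h2
      · ring

theorem isAut_shearFlip : IsAut !![1, φ; 0, -1] shearFlipMap := by
  have h1 := one_lt_phi
  have h2 := phi_mul_phi
  have h0 : 0 ≤ φ := by linarith
  refine IsAut.of_involution (by norm_num) (fun x y => shearFlipMap_shearFlipMap) ?_
    fun x y u w h => ?_
  · rw [singularPoint_eq, shearFlipMap_pt (Or.inl ⟨le_rfl, by linarith, le_rfl, zero_le_one⟩),
      shearFlipPt_bottom_left zero_le_one (by linarith), ← singularPoint_eq]
    exact pt_corner ⟨Or.inl (by ring), Or.inr (Or.inl (by ring))⟩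
  · simp only [zero_mul, one_mul, zero_add]
    rcases eventually_bottom_or_top h with h' | h'
    -- A germ may start on the seam x + φy = φ, but it stays on one side of it for a short time.
    · rcases eventually_le_or_ge (x + φ * y - φ) (u + φ * w) with h3 | h3
      · refine ⟨0, 1, ?_⟩
        filter_upwards [h, h', h3] with s hs hs' hs3
        have h5 : x + s * u + φ * (y + s * w) ≤ φ := by linarith
        have h4 := mul_nonneg h0 hs'.2.2.1
        rw [shearFlipMap_pt hs, shearFlipPt_bottom_left hs'.2.2.2 h5]
        refine ⟨Or.inl ⟨?_, ?_, ?_, ?_⟩, ?_⟩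
        any_goals linarith
        congr 1 <;> ring
      · refine ⟨-φ, 1, ?_⟩
        filter_upwards [h, h', h3] with s hs hs' hs3
        have h5 : φ ≤ x + s * u + φ * (y + s * w) := by linarith
        have h4 := mul_le_mul_of_nonneg_left hs'.2.2.2 h0
        rw [shearFlipMap_pt hs, shearFlipPt_bottom_right hs'.2.2.1 hs'.2.2.2 h5]
        refine ⟨Or.inl ⟨?_, ?_, ?_, ?_⟩, ?_⟩
        any_goals linarith
        congr 1; ring
    · rcases eventually_le_or_ge (x + φ * (y - 1) - 1) (u + φ * w) with h3 | h3
      · refine ⟨-φ, 1 + φ, ?_⟩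
        filter_upwards [h, h', h3] with s hs hs' hs3
        have h5 : x + s * u + φ * (y + s * w - 1) ≤ 1 := by linarith
        have h4 := mul_le_mul_of_nonneg_left hs'.2.2.1 h0
        rw [shearFlipMap_pt hs, shearFlipPt_top_left hs'.1 hs'.2.2.1 h5]
        refine ⟨Or.inr ⟨?_, ?_, ?_, ?_⟩, ?_⟩
        any_goals linarith
        congr 1 <;> ring
      · refine ⟨-φ - 1, 1 + φ, ?_⟩
        filter_upwards [h, h', h3] with s hs hs' hs3
        have h5 : 1 ≤ x + s * u + φ * (y + s * w - 1) := by linarith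
        have h4 := mul_le_mul_of_nonneg_left hs'.2.2.2 h0
        rw [shearFlipMap_pt hs, shearFlipPt_top_right hs'.2.1 hs'.2.2.1 hs'.2.2.2 h5]
        refine ⟨Or.inr ⟨?_, ?_, ?_, ?_⟩, ?_⟩
        any_goals linarith
        congr 1 <;> ring

/-! ### The matrices σᵢ in the Veech group -/

/-- `A` and its inverse `B` are linear parts of affine automorphisms of the golden L. -/
structure IsVeechPair (A B : Matrix (Fin 2) (Fin 2) ℝ) : Prop where
  mul_eq : A * B = 1
  aut : ∃ F, IsAut A F
  aut_inv : ∃ F, IsAut B F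

theorem IsVeechPair.symm {A B : Matrix (Fin 2) (Fin 2) ℝ} (h : IsVeechPair A B) :
    IsVeechPair B A := ⟨mul_eq_one_comm.1 h.mul_eq, h.aut_inv, h.aut⟩

theorem IsVeechPair.one : IsVeechPair 1 1 := ⟨mul_one 1, ⟨_, .one⟩, ⟨_, .one⟩⟩

theorem IsVeechPair.mul {A B A' B' : Matrix (Fin 2) (Fin 2) ℝ} (h : IsVeechPair A B)
    (h' : IsVeechPair A' B') : IsVeechPair (A * A') (B' * B) := by
  obtain ⟨h1, ⟨F, hF⟩, ⟨G, hG⟩⟩ := h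
  obtain ⟨h1', ⟨F', hF'⟩, ⟨G', hG'⟩⟩ := h'
  refine ⟨?_, ⟨_, hF.mul hF'⟩, ⟨_, hG'.mul hG⟩⟩
  rw [mul_assoc, ← mul_assoc A', h1', one_mul, h1]

theorem IsVeechPair.apply_apply {A B : Matrix (Fin 2) (Fin 2) ℝ} (h : IsVeechPair A B)
    (v : Fin 2 → ℝ) : A.mulVec (B.mulVec v) = v := by
  rw [Matrix.mulVec_mulVec, h.mul_eq, Matrix.one_mulVec]

theorem IsVeechPair.saddleConnection_iff {A B : Matrix (Fin 2) (Fin 2) ℝ}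
    (h : IsVeechPair A B) {v : Fin 2 → ℝ} :
    A.mulVec v ∈ saddleConnectionVectors ↔ v ∈ saddleConnectionVectors := by
  obtain ⟨F, hF⟩ := h.aut
  obtain ⟨G, hG⟩ := h.aut_inv
  refine ⟨fun hv => ?_, hF.saddleConnection⟩
  have := hG.saddleConnection hv
  rwa [h.symm.apply_apply] at this

theorem IsVeechPair.cylinder_iff {A B : Matrix (Fin 2) (Fin 2) ℝ}
    (h : IsVeechPair A B) {v : Fin 2 → ℝ} :
    A.mulVec v ∈ cylinderVectors ↔ v ∈ cylinderVectors := by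
  obtain ⟨F, hF⟩ := h.aut
  obtain ⟨G, hG⟩ := h.aut_inv
  refine ⟨fun hv => ?_, hF.cylinder⟩
  have := hG.cylinder hv
  rwa [h.symm.apply_apply] at this

theorem IsVeechPair.long_iff {A B : Matrix (Fin 2) (Fin 2) ℝ}
    (h : IsVeechPair A B) {v : Fin 2 → ℝ} :
    A.mulVec v ∈ longSaddleConnectionVectors ↔ v ∈ longSaddleConnectionVectors := by
  simp only [longSaddleConnectionVectors, mem_ofPred_eq, ← Matrix.mulVec_smul,
    h.saddleConnection_iff]

theorem IsVeechPair.short_iff {A B : Matrix (Fin 2) (Fin 2) ℝ}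
    (h : IsVeechPair A B) {v : Fin 2 → ℝ} :
    A.mulVec v ∈ shortCylinderVectors ↔ v ∈ shortCylinderVectors := by
  simp only [shortCylinderVectors, mem_ofPred_eq, ← Matrix.mulVec_smul, h.cylinder_iff]

theorem isVeechPair_swap : IsVeechPair !![0, 1; 1, 0] !![0, 1; 1, 0] :=
  ⟨by simp [Matrix.one_fin_two], ⟨_, isAut_swap⟩, ⟨_, isAut_swap⟩⟩

theorem isVeechPair_flip : IsVeechPair !![1, 0; 0, -1] !![1, 0; 0, -1] :=
  ⟨by simp [Matrix.one_fin_two], ⟨_, isAut_flip⟩, ⟨_, isAut_flip⟩⟩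

theorem isVeechPair_shearFlip : IsVeechPair !![1, φ; 0, -1] !![1, φ; 0, -1] :=
  ⟨by simp [Matrix.one_fin_two], ⟨_, isAut_shearFlip⟩, ⟨_, isAut_shearFlip⟩⟩

theorem isVeechPair_rotation : IsVeechPair !![0, -1; 1, 0] !![0, 1; -1, 0] := by
  have := isVeechPair_swap.mul isVeechPair_flip
  simpa using this

theorem isVeechPair_shear : IsVeechPair !![1, φ; 0, 1] !![1, -φ; 0, 1] := by
  have := isVeechPair_flip.mul isVeechPair_shearFlip
  simpa using this

/-- The inverses of the matrices `σ₀, σ₁, σ₂, σ₃`. -/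
noncomputable def sigmaInv : Fin 4 → Matrix (Fin 2) (Fin 2) ℝ :=
  ![!![1, -φ; 0, 1], !![φ, -φ; -1, φ], !![φ, -1; -φ, φ], !![1, 0; -φ, 1]]

/-- With T the shear, R the quarter turn and S the swap: σ₀ = T, σ₁ = TRT (using φ² - 1 = φ), σ₂ =
Sσ₁S and σ₃ = STS. -/
theorem isVeechPair_sigma (i : Fin 4) : IsVeechPair (sigma i) (sigmaInv i) := by
  have h2 : φ * φ + -1 = φ := by rw [phi_mul_phi]; ring
  have h3 : 1 + -(φ * φ) = -φ := by rw [phi_mul_phi]; ring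
  have s1 := (isVeechPair_shear.mul isVeechPair_rotation).mul isVeechPair_shear
  have s2 := (isVeechPair_swap.mul s1).mul isVeechPair_swap
  have s3 := (isVeechPair_swap.mul isVeechPair_shear).mul isVeechPair_swap
  fin_cases i
  · exact isVeechPair_shear
  · simpa [sigma, sigmaInv, h2, h3] using s1
  · simpa [sigma, sigmaInv, h2, h3] using s2
  · simpa [sigma, sigmaInv] using s3

/-! ### The horizontal direction -/

theorem straightAfter_linear {v : Fin 2 → ℝ} {x y T t : ℝ}
    (h : ∀ s ∈ Icc 0 T, InL (x + s * v 0) (y + s * v 1)) (ht : t ∈ Ico 0 T) :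
    StraightAfter v (fun s => pt (x + s * v 0) (y + s * v 1)) t := by
  rw [straightAfter_iff]
  refine ⟨x + t * v 0, y + t * v 1, eventually_ge_zero_iff.2 ⟨T - t, by linarith [ht.2], ?_⟩⟩
  intro s hs
  have := h (t + s) ⟨by linarith [hs.1, ht.1], by linarith [hs.2]⟩
  simp only [add_mul, ← add_assoc] at this ⊢
  exact ⟨this, trivial⟩

theorem straightBefore_linear {v : Fin 2 → ℝ} {x y T t : ℝ}
    (h : ∀ s ∈ Icc 0 T, InL (x + s * v 0) (y + s * v 1)) (ht : t ∈ Ioc 0 T) :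
    StraightBefore v (fun s => pt (x + s * v 0) (y + s * v 1)) t := by
  rw [straightBefore_iff]
  refine ⟨x + t * v 0, y + t * v 1, eventually_ge_zero_iff.2 ⟨t, ht.1, ?_⟩⟩
  intro s hs
  have := h (t - s) ⟨by linarith [hs.2], by linarith [hs.1, ht.2]⟩
  simp only [Pi.neg_apply, mul_neg, sub_mul, ← sub_eq_add_neg, ← add_sub_assoc] at this ⊢
  exact ⟨this, trivial⟩

/-- The horizontal path with speed `c` in a cylinder of circumference `L` at height `y`. -/
noncomputable def cylPath (L x y c t : ℝ) : Surface := pt (L * Int.fract ((x + t * c) / L)) y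

/-- The horizontal circle of length `L` at height `y` is in the interior of a cylinder. -/
def IsCircle (L y : ℝ) : Prop := (L = φ ∧ 0 < y ∧ y < 1) ∨ (L = 1 ∧ 1 < y ∧ y < φ)

theorem IsCircle.pos {L y : ℝ} (h : IsCircle L y) : 1 ≤ L := by
  have := one_lt_phi
  rcases h with ⟨rfl, -⟩ | ⟨rfl, -⟩ <;> linarith

theorem IsCircle.inL {L y : ℝ} (h : IsCircle L y) {r : ℝ} (h0 : 0 ≤ r) (h1 : r ≤ L) :
    InL r y := by
  rcases h with ⟨rfl, h2, h3⟩ | ⟨rfl, h2, h3⟩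
  · exact Or.inl ⟨h0, h1, h2.le, h3.le⟩
  · exact Or.inr ⟨h0, h1, by linarith, h3.le⟩

theorem IsCircle.glue {L y : ℝ} (h : IsCircle L y) : pt 0 y = pt L y := by
  rcases h with ⟨rfl, h2, h3⟩ | ⟨rfl, h2, h3⟩
  · exact pt_glue_left h2.le h3.le
  · exact pt_glue_left_top h2.le h3.le

theorem IsCircle.not_corner {L y : ℝ} (h : IsCircle L y) {r : ℝ} : ¬ Corner r y := by
  have := one_lt_phi
  rcases h with ⟨rfl, h2, h3⟩ | ⟨rfl, h2, h3⟩ <;> rintro ⟨-, rfl | rfl | rfl⟩ <;> linarith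

theorem IsCircle.fract_mem {L y : ℝ} (h : IsCircle L y) (z : ℝ) :
    0 ≤ L * Int.fract z ∧ L * Int.fract z < L := by
  have h1 := Int.fract_nonneg z
  have h2 := Int.fract_lt_one z
  have h3 := h.pos
  exact ⟨by positivity, by nlinarith⟩

theorem IsCircle.cylPath_ne {L y : ℝ} (h : IsCircle L y) (x c t : ℝ) :
    cylPath L x y c t ≠ singularPoint := fun he =>
  h.not_corner (corner_of_pt_eq (h.inL (h.fract_mem _).1 (h.fract_mem _).2.le) he)

theorem IsCircle.cylPath_eq {L y : ℝ} (h : IsCircle L y) {x c t : ℝ} {n : ℤ}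
    (h1 : 0 ≤ x + t * c - n * L) (h2 : x + t * c - n * L ≤ L) :
    cylPath L x y c t = pt (x + t * c - n * L) y := by
  have hL : 0 < L := zero_lt_one.trans_le h.pos
  rw [cylPath]
  rcases h2.lt_or_eq with h2 | h2
  · congr 1
    have : Int.fract ((x + t * c) / L) = (x + t * c - n * L) / L := by
      rw [Int.fract_eq_iff]
      refine ⟨by positivity, by rwa [div_lt_one hL], n, ?_⟩
      field_simp
      ring
    rw [this, mul_div_cancel₀ _ hL.ne']
  · rw [h2, ← h.glue]
    have : (x + t * c) / L = ((n + 1 : ℤ) : ℝ) := by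
      rw [div_eq_iff hL.ne']
      push_cast
      linarith
    rw [this, Int.fract_intCast, mul_zero]

theorem IsCircle.exists_of_cylPath_eq {L y : ℝ} (h : IsCircle L y) {x c s t : ℝ}
    (he : cylPath L x y c s = cylPath L x y c t) : ∃ n : ℤ, (s - t) * c = n * L := by
  have hL : 0 < L := zero_lt_one.trans_le h.pos
  have h1 := h.fract_mem ((x + s * c) / L)
  have h2 := h.fract_mem ((x + t * c) / L)
  have hφ := one_lt_phi
  have := rel_of_pt_eq (h.inL h1.1 h1.2.le) (h.inL h2.1 h2.2.le) he
  have he : L * Int.fract ((x + s * c) / L) = L * Int.fract ((x + t * c) / L) := by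
    rcases h with ⟨rfl, h3, h4⟩ | ⟨rfl, h3, h4⟩ <;> simp only [Rel, Corner] at this <;> grind
  obtain ⟨n, hn⟩ := Int.fract_eq_fract.1 (mul_left_cancel₀ hL.ne' he)
  refine ⟨n, ?_⟩
  rw [← sub_div, div_eq_iff hL.ne'] at hn
  linarith

/-- The velocity d is independent of c so that d = c and d = -c give the germs after and before time
t. -/
theorem IsCircle.germ {L y : ℝ} (h : IsCircle L y) (x c t d : ℝ) (γ : ℝ → Surface)
    (hγ : ∀ s, γ s = cylPath L (x + t * c) y d s) : Germ ![d, 0] γ := by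
  have hL : 0 < L := zero_lt_one.trans_le h.pos
  set z := x + t * c with hz
  have hf0 := Int.fract_nonneg (z / L)
  have hf1 := Int.fract_lt_one (z / L)
  set n := ⌊z / L⌋ with hn
  have e : z - n * L = L * Int.fract (z / L) := by
    rw [Int.fract, mul_sub, mul_div_cancel₀ _ hL.ne', ← hn]; ring
  have a0 : 0 ≤ z - n * L := by rw [e]; positivity
  have a1 : z - n * L < L := by rw [e]; nlinarith
  have hc : ContinuousAt (fun s : ℝ => z - n * L + s * d) 0 := by fun_prop
  have e1 : ∀ᶠ s in 𝓝[≥] (0 : ℝ), z - n * L + s * d < L :=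
    (hc.eventually (gt_mem_nhds (by simpa using a1))).filter_mono nhdsWithin_le_nhds
  have e2 : ∀ᶠ s in 𝓝[≥] (0 : ℝ), -L < z - n * L + s * d :=
    (hc.eventually (lt_mem_nhds (by simp only [zero_mul, add_zero]; linarith))).filter_mono
      nhdsWithin_le_nhds
  -- A path moving left from the edge x = 0 must be represented from the right edge, which replaces
  -- n by n - 1.
  have key : ∃ k : ℤ, ∀ᶠ s in 𝓝[≥] (0 : ℝ), 0 ≤ z + s * d - k * L ∧ z + s * d - k * L ≤ L := by
    rcases eventually_le_or_ge (z - n * L) d with h' | h'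
    · refine ⟨n - 1, ?_⟩
      filter_upwards [h', e2] with s h1 h2
      push_cast
      constructor <;> linarith
    · refine ⟨n, ?_⟩
      filter_upwards [h', e1] with s h1 h2
      constructor <;> linarith
  obtain ⟨k, hk⟩ := key
  refine ⟨z - k * L, y, hk.mono fun s hs => ?_⟩
  simp only [Matrix.cons_val_zero, Matrix.cons_val_one, mul_zero, add_zero]
  have e3 : z - k * L + s * d = z + s * d - k * L := by ring
  rw [e3]
  exact ⟨h.inL hs.1 hs.2, by rw [hγ, h.cylPath_eq hs.1 hs.2]⟩

theorem IsCircle.straightAfter {L y : ℝ} (h : IsCircle L y) (x c t : ℝ) :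
    StraightAfter ![c, 0] (cylPath L x y c) t := by
  rw [straightAfter_iff]
  refine h.germ x c t c _ fun s => ?_
  simp only [cylPath]
  ring_nf

theorem IsCircle.straightBefore {L y : ℝ} (h : IsCircle L y) (x c t : ℝ) :
    StraightBefore ![c, 0] (cylPath L x y c) t := by
  rw [straightBefore_iff]
  have : -![c, 0] = ![-c, 0] := by ext i; fin_cases i <;> simp
  rw [this]
  refine h.germ x c t (-c) _ fun s => ?_
  simp only [cylPath]
  ring_nf

theorem e1_mem_cylinderVectors : ![1, 0] ∈ cylinderVectors := by
  -- Any height strictly between 1 and φ would do.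
  have h : IsCircle 1 (3 / 2) := Or.inr ⟨rfl, by norm_num, by
    rw [Real.goldenRatio]
    have : (2 : ℝ) < √5 := by rw [Real.lt_sqrt] <;> norm_num
    linarith⟩
  refine ⟨fun h => by simpa using congrFun h 0, cylPath 1 0 (3 / 2) 1, h.cylPath_ne _ _,
    h.straightAfter _ _, h.straightBefore _ _, fun t => ?_, fun s hs hp => ?_⟩
  · simp [cylPath]
  · have := hp 0
    obtain ⟨n, hn⟩ := h.exists_of_cylPath_eq this
    have hn : s = n := by linarith
    have h1 := hs.1
    have h2 := hs.2
    rw [hn] at h1 h2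
    have h1 : 0 < n := by exact_mod_cast h1
    have h2 : n < 1 := by exact_mod_cast h2
    omega

theorem e1_mem_saddleConnectionVectors : ![1, 0] ∈ saddleConnectionVectors := by
  have h1 := one_lt_phi
  have h : ∀ s ∈ Icc (0 : ℝ) 1, InL (0 + s * (![1, 0] : Fin 2 → ℝ) 0)
      (0 + s * (![1, 0] : Fin 2 → ℝ) 1) := by
    intro s hs
    simp only [Matrix.cons_val_zero, Matrix.cons_val_one, mul_zero, add_zero, mul_one, zero_add]
    exact Or.inr ⟨hs.1, hs.2, le_rfl, by linarith⟩
  refine ⟨fun h => by simpa using congrFun h 0, _, ?_, ?_, fun t ht he => ?_,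
    fun t ht => straightAfter_linear h ht, fun t ht => straightBefore_linear h ht⟩
  · simp [singularPoint_eq]
  · exact pt_corner ⟨by simp, by simp⟩
  · have := corner_of_pt_eq (h t (Ioo_subset_Icc_self ht)) he
    simp only [Matrix.cons_val_zero, Matrix.cons_val_one, mul_zero, add_zero, mul_one, zero_add,
      Corner] at this
    have h3 := ht.1
    have h4 := ht.2
    grind

/-- A horizontal path that starts straight towards a singular point on its line meets it. -/
theorem eq_singularPoint_of_horizontal {c x y L : ℝ} {γ : ℝ → Surface} (hc : 0 < c)
    (hL : 0 < L)
    (ha : ∀ t ∈ Ioo 0 (L / c), StraightAfter ![c, 0] γ t)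
    (hb : ∀ t ∈ Ioc 0 (L / c), StraightBefore ![c, 0] γ t)
    (hn : ∀ t ∈ Ioo 0 (L / c), γ t ≠ singularPoint)
    (h0 : ∀ᶠ s in 𝓝[≥] (0 : ℝ), γ s = pt (x + s * c) y)
    (hin : ∀ r ∈ Icc 0 L, InL (x + r) y) (hcor : Corner (x + L) y) :
    γ (L / c) = singularPoint := by
  have hv : ∀ s ∈ Icc 0 (L / c), InL (x + s * (![c, 0] : Fin 2 → ℝ) 0)
      (y + s * (![c, 0] : Fin 2 → ℝ) 1) := by
    intro s hs
    simp only [Matrix.cons_val_zero, Matrix.cons_val_one, mul_zero, add_zero]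
    exact hin _ ⟨mul_nonneg hs.1 hc.le, (le_div_iff₀ hc).1 hs.2⟩
  have := straight_unique ha hb (fun t ht => straightAfter_linear hv (Ioo_subset_Ico_self ht))
    (fun t ht => straightBefore_linear hv ht) hn
    (by simpa only [Matrix.cons_val_zero, Matrix.cons_val_one, mul_zero, add_zero] using h0)
    (L / c) ⟨by positivity, le_rfl⟩
  rw [this]
  simp only [Matrix.cons_val_zero, Matrix.cons_val_one, mul_zero, add_zero]
  rw [div_mul_cancel₀ _ hc.ne']
  exact pt_corner hcor

/-- From a corner, the next corner to the right is at distance 1 or φ - 1, so a longer path would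
meet the singular point too early. -/
theorem le_one_of_smul_e1_mem_saddleConnectionVectors {c : ℝ} (hc : 0 < c)
    (h : ![c, 0] ∈ saddleConnectionVectors) : c ≤ 1 := by
  have h1 := one_lt_phi
  have h2 := phi_lt_two
  by_contra! hc1
  obtain ⟨-, γ, g0, -, gn, ga, gb⟩ := h
  obtain ⟨x, y, hg⟩ := straightAfter_iff.1 (ga 0 ⟨le_rfl, zero_lt_one⟩)
  simp only [Matrix.cons_val_zero, Matrix.cons_val_one, mul_zero, add_zero, zero_add] at hg
  obtain ⟨ε, hε, hg'⟩ := eventually_ge_zero_iff.1 hg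
  have i0 := hg' 0 ⟨le_rfl, hε.le⟩
  have i1 := (hg' ε ⟨hε.le, le_rfl⟩).1
  rw [zero_mul, add_zero, g0] at i0
  have hcor := corner_of_pt_eq i0.1 i0.2.symm
  have i0 := i0.1
  have : 0 < ε * c := mul_pos hε hc
  obtain ⟨L, hL, hL1, hin, hcor⟩ :
      ∃ L, 0 < L ∧ L ≤ 1 ∧ (∀ r ∈ Icc 0 L, InL (x + r) y) ∧ Corner (x + L) y := by
    clear hg hg'
    simp only [InL, Corner, mem_Icc] at *
    rcases hcor.1 with rfl | rfl | rfl
    · exact ⟨1, by grind⟩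
    · exact ⟨φ - 1, by grind⟩
    · grind
  have hlt : L / c < 1 := (div_lt_one hc).2 (by linarith)
  have hpos : 0 < L / c := div_pos hL hc
  exact gn _ ⟨hpos, hlt⟩ (eq_singularPoint_of_horizontal hc hL
    (fun t ht => ga t ⟨ht.1.le, ht.2.trans hlt⟩) (fun t ht => gb t ⟨ht.1, ht.2.trans hlt.le⟩)
    (fun t ht => gn t ⟨ht.1, ht.2.trans hlt⟩) (hg.mono fun _ h => h.2) hin hcor)

theorem one_le_of_smul_e1_mem_cylinderVectors {c : ℝ} (hc : 0 < c)
    (h : ![c, 0] ∈ cylinderVectors) : 1 ≤ c := by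
  have h1 := one_lt_phi
  have h2 := phi_lt_two
  obtain ⟨-, γ, gn, ga, gb, gp, -⟩ := h
  obtain ⟨x, y, hg⟩ := straightAfter_iff.1 (ga 0)
  simp only [Matrix.cons_val_zero, Matrix.cons_val_one, mul_zero, add_zero, zero_add] at hg
  obtain ⟨ε, hε, hg'⟩ := eventually_ge_zero_iff.1 hg
  have i0 := hg' 0 ⟨le_rfl, hε.le⟩
  have i1 := (hg' ε ⟨hε.le, le_rfl⟩).1
  rw [zero_mul, add_zero] at i0
  have hcor : ¬ Corner x y := fun h => gn 0 (by rw [i0.2, pt_corner h])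
  have i0 := i0.1
  have hpos : 0 < ε * c := mul_pos hε hc
  -- Either the path runs around a cylinder, or its height is 0, 1 or φ and it runs into a corner.
  have hcases : (∃ L, IsCircle L y ∧ x < L) ∨
      ∃ L, 0 < L ∧ (∀ r ∈ Icc 0 L, InL (x + r) y) ∧ Corner (x + L) y := by
    clear hg hg' ga gb gn gp
    by_cases hy : y = 0 ∨ y = 1 ∨ y = φ
    · right
      rcases lt_or_ge x 1 with hx | hx
      · refine ⟨1 - x, ?_⟩
        simp only [InL, Corner, mem_Icc] at *
        grind
      · refine ⟨φ - x, ?_⟩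
        simp only [InL, Corner, mem_Icc] at *
        grind
    · left
      rcases lt_or_ge y 1 with hx | hx
      · refine ⟨φ, ?_⟩
        simp only [InL, IsCircle] at *
        grind
      · refine ⟨1, ?_⟩
        simp only [InL, IsCircle] at *
        grind
  rcases hcases with ⟨L, hL, hx⟩ | ⟨L, hL, hin, hcor⟩
  · have hx0 : 0 ≤ x := by simp only [InL] at i0; grind
    have hev : ∀ᶠ s in 𝓝[≥] (0 : ℝ), γ s = cylPath L x y c s := by
      have hcont : ContinuousAt (fun s : ℝ => x + s * c) 0 := by fun_prop
      have e1 : ∀ᶠ s in 𝓝[≥] (0 : ℝ), x + s * c < L :=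
        (hcont.eventually (gt_mem_nhds (by simpa using hx))).filter_mono nhdsWithin_le_nhds
      filter_upwards [hg, e1, self_mem_nhdsWithin] with s hs hs1 hs0
      have hs0 : 0 ≤ s * c := mul_nonneg hs0 hc.le
      rw [hs.2, hL.cylPath_eq (n := 0) (by simp; linarith) (by simp; linarith)]
      simp
    have key := straight_unique (T := 1) (fun t _ => ga t) (fun t _ => gb t)
      (fun t _ => hL.straightAfter x c t) (fun t _ => hL.straightBefore x c t)
      (fun t _ => gn t) hev
    have e : cylPath L x y c 1 = cylPath L x y c 0 := by
      rw [← key 1 ⟨zero_le_one, le_rfl⟩, ← key 0 ⟨le_rfl, zero_le_one⟩]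
      simpa using gp 0
    obtain ⟨n, hn⟩ := hL.exists_of_cylPath_eq e
    have hL1 := hL.pos
    have hn0 : 0 < n := by
      by_contra! hn0
      have : (n : ℝ) ≤ 0 := by exact_mod_cast hn0
      nlinarith
    have : (1 : ℝ) ≤ n := by exact_mod_cast hn0
    nlinarith
  · exact absurd (eq_singularPoint_of_horizontal hc hL (fun t _ => ga t) (fun t _ => gb t)
      (fun t _ => gn t) (hg.mono fun _ h => h.2) hin hcor) (gn _)

/-! ### Finiteness of bounded holonomy -/

/-- The real numbers `a + b φ` with natural numbers `a`, `b`. -/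
def IsNatPhi (r : ℝ) : Prop := ∃ a b : ℕ, r = a + b * φ

theorem IsNatPhi.add {r s : ℝ} (hr : IsNatPhi r) (hs : IsNatPhi s) : IsNatPhi (r + s) := by
  obtain ⟨a, b, rfl⟩ := hr
  obtain ⟨c, d, rfl⟩ := hs
  exact ⟨a + c, b + d, by push_cast; ring⟩

theorem isNatPhi_zero : IsNatPhi 0 := ⟨0, 0, by simp⟩

theorem isNatPhi_one : IsNatPhi 1 := ⟨1, 0, by simp⟩

theorem isNatPhi_phi : IsNatPhi φ := ⟨0, 1, by simp⟩

/-- A path going up and to the right can only continue from a left or bottom side, so crossing a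
gluing lowers a coordinate by 1 or φ and never raises one. -/
theorem isNatPhi_sub_of_rel {x y x' y' u w : ℝ} (hu : 0 < u) (hw : 0 < w)
    (h : Rel x y x' y') (hc : ¬ Corner x y) (hin : InL (x' + u) (y' + w)) :
    IsNatPhi (x - x') ∧ IsNatPhi (y - y') := by
  have h1 := one_lt_phi
  rcases h with ⟨rfl, rfl⟩ | ⟨hc', -⟩ | ⟨rfl, a, b, ⟨rfl, rfl⟩ | ⟨rfl, rfl⟩⟩ |
    ⟨rfl, a, b, ⟨rfl, rfl⟩ | ⟨rfl, rfl⟩⟩ | ⟨rfl, a, b, ⟨rfl, rfl⟩ | ⟨rfl, rfl⟩⟩ |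
    ⟨rfl, a, b, ⟨rfl, rfl⟩ | ⟨rfl, rfl⟩⟩
  · simp [isNatPhi_zero]
  · exact absurd hc' hc
  all_goals first
    | (exfalso; simp only [InL] at hin; grind)
    | simp [isNatPhi_zero, isNatPhi_one, isNatPhi_phi]

/-- A point from which the region extends both up-right and down-left lies on no glued side, so it
has a single representative. -/
theorem eq_of_rel_of_interior {x y x' y' u w d e : ℝ} (hu : 0 < u) (hw : 0 < w) (hd : 0 < d)
    (he : 0 < e) (h : Rel x y x' y') (h1 : InL (x' + u) (y' + w)) (h2 : InL (x' - d) (y' - e)) :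
    x = x' ∧ y = y' := by
  have hφ := one_lt_phi
  simp only [InL, Rel, Corner] at *
  grind

theorem exists_holonomy {v : Fin 2 → ℝ} {γ : ℝ → Surface} (h0 : 0 < v 0) (h1 : 0 < v 1)
    (ha : ∀ t ∈ Ico 0 1, StraightAfter v γ t) (hb : ∀ t ∈ Ioc 0 1, StraightBefore v γ t)
    (hn : ∀ t ∈ Ioo 0 1, γ t ≠ singularPoint) :
    ∃ x y X Y, InL x y ∧ InL X Y ∧ γ 0 = pt x y ∧ γ 1 = pt X Y ∧
      IsNatPhi (x + v 0 - X) ∧ IsNatPhi (y + v 1 - Y) := by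
  obtain ⟨x, y, hg⟩ := straightAfter_iff.1 (ha 0 ⟨le_rfl, zero_lt_one⟩)
  simp only [zero_add] at hg
  have hg0 := hg.self_of_nhdsWithin (mem_Ici.2 le_rfl)
  simp only [zero_mul, add_zero] at hg0
  have hev : ∀ᶠ s in 𝓝[≥] (0 : ℝ), ∃ X Y, InL X Y ∧ γ s = pt X Y ∧
      IsNatPhi (x + s * v 0 - X) ∧ IsNatPhi (y + s * v 1 - Y) :=
    hg.mono fun s hs => ⟨_, _, hs.1, hs.2, by simp [isNatPhi_zero]⟩
  have key := real_induction (T := 1) (P := fun t => ∃ X Y, InL X Y ∧ γ t = pt X Y ∧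
    IsNatPhi (x + t * v 0 - X) ∧ IsNatPhi (y + t * v 1 - Y))
    (hev.self_of_nhdsWithin (mem_Ici.2 le_rfl)) ?_ ?_ 1 ⟨zero_le_one, le_rfl⟩
  · obtain ⟨X, Y, h2, h3, h4, h5⟩ := key
    rw [one_mul] at h4 h5
    exact ⟨x, y, X, Y, hg0.1, h2, hg0.2, h3, h4, h5⟩
  · rintro t ht ⟨X, Y, h2, h3, h4, h5⟩
    rcases ht.1.eq_or_lt with rfl | h_pos
    · simpa using hev
    obtain ⟨X', Y', h⟩ := straightAfter_iff.1 (ha t ht)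
    beta_reduce at h
    obtain ⟨ε, hε, h'⟩ := eventually_ge_zero_iff.1 h
    have i0 := h' 0 ⟨le_rfl, hε.le⟩
    have i1 := (h' ε ⟨hε.le, le_rfl⟩).1
    simp only [zero_mul, add_zero] at i0
    have hrel := rel_of_pt_eq h2 i0.1 (h3.symm.trans i0.2)
    have hnc : ¬ Corner X Y := fun h => hn t ⟨h_pos, ht.2⟩ (by rw [h3, pt_corner h])
    obtain ⟨j0, j1⟩ := isNatPhi_sub_of_rel (mul_pos hε h0) (mul_pos hε h1) hrel hnc i1
    refine h.mono fun s hs => ⟨_, _, hs.1, hs.2, ?_, ?_⟩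
    · convert h4.add j0 using 1; ring
    · convert h5.add j1 using 1; ring
  · intro t ht hs
    obtain ⟨X', Y', h⟩ := straightBefore_iff.1 (hb t ht)
    obtain ⟨ε, hε, h'⟩ := eventually_ge_zero_iff.1 h
    simp only [Pi.neg_apply] at h'
    -- s < ε lets the segment extend to both sides of time t - s, where the representative is then
    -- unique.
    set s := min (ε / 2) (t / 2) with hsdef
    have hs0 : 0 < s := lt_min (half_pos hε) (half_pos ht.1)
    have hst : s < t := (min_le_right _ _).trans_lt (half_lt_self ht.1)
    have hsε : s < ε := (min_le_left _ _).trans_lt (half_lt_self hε)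
    obtain ⟨X, Y, h2, h3, h4, h5⟩ := hs (t - s) ⟨by linarith, by linarith⟩
    have i0 := h' 0 ⟨le_rfl, hε.le⟩
    have i1 := h' s ⟨hs0.le, hsε.le⟩
    have i2 := (h' ε ⟨hε.le, le_rfl⟩).1
    simp only [zero_mul, add_zero, sub_zero] at i0
    obtain ⟨j0, j1⟩ := eq_of_rel_of_interior (mul_pos hs0 h0) (mul_pos hs0 h1)
      (mul_pos (sub_pos.2 hsε) h0) (mul_pos (sub_pos.2 hsε) h1)
      (rel_of_pt_eq h2 i1.1 (h3.symm.trans i1.2))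
      (by convert i0.1 using 1 <;> ring) (by convert i2 using 1 <;> ring)
    refine ⟨X', Y', i0.1, i0.2, ?_, ?_⟩
    · convert h4 using 1; rw [j0]; ring
    · convert h5 using 1; rw [j1]; ring

theorem sub_of_rel {x y x' y' : ℝ} (h : Rel x y x' y') :
    (∃ e ∈ ({0, 1, φ} : Set ℝ), ∃ f ∈ ({0, 1, φ} : Set ℝ), x - x' = e - f) ∧
    ∃ e ∈ ({0, 1, φ} : Set ℝ), ∃ f ∈ ({0, 1, φ} : Set ℝ), y - y' = e - f := by
  have key : ∀ a b : ℝ, a = b ∨ (a = 0 ∨ a = 1 ∨ a = φ) ∧ (b = 0 ∨ b = 1 ∨ b = φ) →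
      ∃ e ∈ ({0, 1, φ} : Set ℝ), ∃ f ∈ ({0, 1, φ} : Set ℝ), a - b = e - f := by
    rintro a b (rfl | ⟨ha, hb⟩)
    · exact ⟨0, by simp, 0, by simp, by simp⟩
    · exact ⟨a, by simpa using ha, b, by simpa using hb, rfl⟩
  simp only [Rel, Corner] at h
  exact ⟨key _ _ (by tauto), key _ _ (by tauto)⟩

/-- The coordinates of the holonomy vectors. -/
def holonomySet (N : ℕ) : Set ℝ :=
  (fun p : ℝ × ℝ × ℕ × ℕ => p.1 - p.2.1 + (p.2.2.1 + p.2.2.2 * φ)) ''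
    (({0, 1, φ} : Set ℝ) ×ˢ ({0, 1, φ} : Set ℝ) ×ˢ Iic N ×ˢ Iic N)

theorem holonomySet_finite (N : ℕ) : (holonomySet N).Finite := by
  have h : ({0, 1, φ} : Set ℝ).Finite := toFinite _
  exact (h.prod (h.prod ((finite_Iic N).prod (finite_Iic N)))).image _

theorem mem_holonomySet {r d : ℝ} {N : ℕ} (hr : r ≤ N - 2)
    (hd : ∃ e ∈ ({0, 1, φ} : Set ℝ), ∃ f ∈ ({0, 1, φ} : Set ℝ), d = e - f)
    (h : IsNatPhi (d + r)) : r ∈ holonomySet N := by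
  have h1 := one_lt_phi
  have h2 := phi_lt_two
  obtain ⟨e, he, f, hf, rfl⟩ := hd
  obtain ⟨a, b, hab⟩ := h
  have hef : e - f ≤ 2 := by
    simp only [mem_insert_iff, mem_singleton_iff] at he hf
    rcases he with rfl | rfl | rfl <;> rcases hf with rfl | rfl | rfl <;> linarith
  have ha : (0 : ℝ) ≤ a := Nat.cast_nonneg a
  have hb : (0 : ℝ) ≤ b := Nat.cast_nonneg b
  have hb' : (b : ℝ) ≤ b * φ := le_mul_of_one_le_right hb h1.le
  refine ⟨(f, e, a, b), ⟨hf, he, ?_, ?_⟩, ?_⟩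
  · exact mem_Iic.2 (by exact_mod_cast (show (a : ℝ) ≤ N by linarith))
  · exact mem_Iic.2 (by exact_mod_cast (show (b : ℝ) ≤ N by linarith))
  · change f - e + (a + b * φ) = r
    linarith

/-- ℤ[φ] is dense, so finiteness rests on the coefficients in `exists_holonomy` being natural
numbers: a bound on a + bφ then bounds a and b. The end representatives add only a difference of
elements of {0, 1, φ}, which is below 2. -/
theorem finite_of_bounded (R : ℝ) :
    {v | v ∈ saddleConnectionVectors ∪ cylinderVectors ∧ 0 < v 0 ∧ 0 < v 1 ∧
      v 0 + v 1 ≤ R}.Finite := by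
  obtain ⟨N, hN⟩ := exists_nat_ge (R + 2)
  refine (Set.Finite.pi (fun _ : Fin 2 => holonomySet_finite N)).subset ?_
  rintro v ⟨hv, h0, h1, hR⟩
  obtain ⟨γ, he, ha, hb, hn⟩ : ∃ γ : ℝ → Surface, γ 0 = γ 1 ∧
      (∀ t ∈ Ico (0 : ℝ) 1, StraightAfter v γ t) ∧
      (∀ t ∈ Ioc (0 : ℝ) 1, StraightBefore v γ t) ∧
      ∀ t ∈ Ioo (0 : ℝ) 1, γ t ≠ singularPoint := by
    rcases hv with ⟨-, γ, g0, g1, hn, ha, hb⟩ | ⟨-, γ, hn, ha, hb, hp, -⟩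
    · exact ⟨γ, g0.trans g1.symm, ha, hb, hn⟩
    · exact ⟨γ, by simpa using (hp 0).symm, fun t _ => ha t, fun t _ => hb t, fun t _ => hn t⟩
  obtain ⟨x, y, X, Y, hin, hin', e0, e1, hx, hy⟩ := exists_holonomy h0 h1 ha hb hn
  obtain ⟨hdx, hdy⟩ := sub_of_rel (rel_of_pt_eq hin hin' (by rw [← e0, ← e1, he]))
  intro i _
  fin_cases i
  · exact mem_holonomySet (by simp; linarith) hdx (by convert hx using 1; simp; ring)
  · exact mem_holonomySet (by simp; linarith) hdy (by convert hy using 1; simp; ring)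

/-! ### Words, sectors and descent -/

theorem m_append_singleton (w : List (Fin 4)) (k : Fin 4) : m (w ++ [k]) = sigma k * m w := by
  induction w with
  | nil => simp [m]
  | cons a w ih => simp only [List.cons_append, m, ih, mul_assoc]

theorem exists_isVeechPair_m (w : List (Fin 4)) : ∃ B, IsVeechPair (m w) B := by
  induction w with
  | nil => exact ⟨_, .one⟩
  | cons a w ih =>
    obtain ⟨B, hB⟩ := ih
    exact ⟨_, hB.mul (isVeechPair_sigma a)⟩

theorem sigma_mulVec_mem {v : Fin 2 → ℝ} (k : Fin 4) (h : v ∈ firstQuadrant) :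
    (sigma k).mulVec v ∈ firstQuadrant := by
  obtain ⟨h0, h1⟩ := h
  have hφ : 0 < φ := Real.goldenRatio_pos
  fin_cases k <;> constructor <;>
    simp [sigma, Matrix.mulVec, dotProduct, Fin.sum_univ_two] <;> positivity

theorem m_mulVec_mem {v : Fin 2 → ℝ} (w : List (Fin 4)) (h : v ∈ firstQuadrant) :
    (m w).mulVec v ∈ firstQuadrant := by
  induction w generalizing v with
  | nil => simpa [m] using h
  | cons a w ih =>
    rw [m, ← Matrix.mulVec_mulVec]
    exact ih (sigma_mulVec_mem a h)

theorem e1_mem_firstQuadrant : (![1, 0] : Fin 2 → ℝ) ∈ firstQuadrant := by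
  constructor <;> simp

theorem sigmaInv_zero_mulVec (v : Fin 2 → ℝ) :
    (sigmaInv 0).mulVec v = ![v 0 - φ * v 1, v 1] := by
  ext i; fin_cases i <;>
    simp [sigmaInv, Matrix.mulVec, dotProduct, Fin.sum_univ_two]; ring

theorem sigmaInv_one_mulVec (v : Fin 2 → ℝ) :
    (sigmaInv 1).mulVec v = ![φ * v 0 - φ * v 1, φ * v 1 - v 0] := by
  ext i; fin_cases i <;>
    simp [sigmaInv, Matrix.mulVec, dotProduct, Fin.sum_univ_two] <;> ring

theorem sigmaInv_two_mulVec (v : Fin 2 → ℝ) :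
    (sigmaInv 2).mulVec v = ![φ * v 0 - v 1, φ * v 1 - φ * v 0] := by
  ext i; fin_cases i <;>
    simp [sigmaInv, Matrix.mulVec, dotProduct, Fin.sum_univ_two] <;> ring

theorem sigmaInv_three_mulVec (v : Fin 2 → ℝ) :
    (sigmaInv 3).mulVec v = ![v 0, v 1 - φ * v 0] := by
  ext i; fin_cases i <;>
    simp [sigmaInv, Matrix.mulVec, dotProduct, Fin.sum_univ_two]; ring

/-- A vector in the open first quadrant is the image under some `σᵢ` of a smaller vector. -/
theorem exists_sigmaInv_mem {v : Fin 2 → ℝ} (h0 : 0 < v 0) (h1 : 0 < v 1) :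
    ∃ i, (sigmaInv i).mulVec v ∈ firstQuadrant ∧
      ((sigmaInv i).mulVec v) 0 + ((sigmaInv i).mulVec v) 1 < v 0 + v 1 := by
  have hφ := one_lt_phi
  have hφ2 := phi_lt_two
  have p0 : v 0 < φ * v 0 := lt_mul_of_one_lt_left h0 hφ
  have p1 : v 1 < φ * v 1 := lt_mul_of_one_lt_left h1 hφ
  have q0 : φ * v 0 < 2 * v 0 := mul_lt_mul_of_pos_right hφ2 h0
  have q1 : φ * v 1 < 2 * v 1 := mul_lt_mul_of_pos_right hφ2 h1
  simp only [firstQuadrant, mem_ofPred_eq]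
  -- The sectors are separated by the slopes 1/φ, 1 and φ; each contains its lower boundary ray and
  -- not its upper one, as Σ does.
  by_cases c0 : φ * v 1 < v 0
  · refine ⟨0, ?_⟩
    simp only [sigmaInv_zero_mulVec, Matrix.cons_val_zero, Matrix.cons_val_one]
    exact ⟨⟨by linarith, by linarith⟩, by linarith⟩
  by_cases c1 : v 1 < v 0
  · refine ⟨1, ?_⟩
    have := mul_lt_mul_of_pos_left c1 (zero_lt_one.trans hφ)
    simp only [sigmaInv_one_mulVec, Matrix.cons_val_zero, Matrix.cons_val_one]
    exact ⟨⟨by linarith, by linarith⟩, by linarith⟩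
  by_cases c2 : v 1 < φ * v 0
  · refine ⟨2, ?_⟩
    have := mul_le_mul_of_nonneg_left (not_lt.1 c1) (zero_lt_one.trans hφ).le
    simp only [sigmaInv_two_mulVec, Matrix.cons_val_zero, Matrix.cons_val_one]
    exact ⟨⟨by linarith, by linarith⟩, by linarith⟩
  · refine ⟨3, ?_⟩
    simp only [sigmaInv_three_mulVec, Matrix.cons_val_zero, Matrix.cons_val_one]
    exact ⟨⟨by linarith, by linarith⟩, by linarith⟩

/-- The images of the first quadrant under the `σᵢ` are pairwise disjoint. -/
theorem sigmaInv_mem_unique {v : Fin 2 → ℝ} (h : v ∈ firstQuadrant) {i j : Fin 4}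
    (hi : (sigmaInv i).mulVec v ∈ firstQuadrant) (hj : (sigmaInv j).mulVec v ∈ firstQuadrant) :
    i = j := by
  wlog hij : i < j generalizing i j
  · rcases (not_lt.1 hij).eq_or_lt with h' | h'
    · exact h'.symm
    · exact (this hj hi h').symm
  exfalso
  obtain ⟨h0, h1⟩ := h
  have hφ := one_lt_phi
  have p0 : v 0 < φ * v 0 := lt_mul_of_one_lt_left h0 hφ
  have p1 : v 1 ≤ φ * v 1 := le_mul_of_one_le_left h1 hφ.le
  simp only [firstQuadrant, mem_ofPred_eq] at hi hj
  fin_cases i <;> fin_cases j <;> simp at hij <;>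
    simp only [Fin.zero_eta, Fin.mk_one, Fin.reduceFinMk, sigmaInv_zero_mulVec,
      sigmaInv_one_mulVec, sigmaInv_two_mulVec, sigmaInv_three_mulVec, Matrix.cons_val_zero,
      Matrix.cons_val_one] at hi hj <;>
    linarith [hi.1, hi.2, hj.1, hj.2]

theorem sigma_mulVec_inj {u v : Fin 2 → ℝ} {i j : Fin 4} (hu : u ∈ firstQuadrant)
    (hv : v ∈ firstQuadrant) (h : (sigma i).mulVec u = (sigma j).mulVec v) : i = j ∧ u = v := by
  have h1 := (isVeechPair_sigma i).symm.apply_apply u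
  have h2 := (isVeechPair_sigma j).symm.apply_apply v
  have hij : i = j := sigmaInv_mem_unique (sigma_mulVec_mem i hu) (by rwa [h1])
    (by rwa [h, h2])
  subst hij
  exact ⟨rfl, by rw [← h1, ← h2, h]⟩

/-- Saddle connections and cylinders have the directions of the vectors `m(w) e₁`. -/
theorem exists_word {v : Fin 2 → ℝ} (hv : v ∈ saddleConnectionVectors ∪ cylinderVectors)
    (hq : v ∈ firstQuadrant) : ∃ w, ∃ c : ℝ, 0 < c ∧ v = (m w).mulVec ![c, 0] := by
  by_contra hbad
  set B : Set (Fin 2 → ℝ) := {u | (u ∈ saddleConnectionVectors ∪ cylinderVectors ∧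
    u ∈ firstQuadrant ∧ ¬ ∃ w, ∃ c : ℝ, 0 < c ∧ u = (m w).mulVec ![c, 0]) ∧
    u 0 + u 1 ≤ v 0 + v 1} with hB
  -- A horizontal vector is no counterexample, since the empty word serves it.
  have hpos : ∀ u ∈ B, 0 < u 0 ∧ 0 < u 1 := by
    rintro u ⟨⟨-, h2, h3⟩, -⟩
    refine ⟨h2.1, lt_of_le_of_ne h2.2 fun h => h3 ⟨[], u 0, h2.1, ?_⟩⟩
    ext i
    fin_cases i <;> simp [m, ← h]
  have hfin : B.Finite := (finite_of_bounded (v 0 + v 1)).subset fun u hu =>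
    ⟨hu.1.1, (hpos u hu).1, (hpos u hu).2, hu.2⟩
  -- In a counterexample with least x + y, undoing the σᵢ of its sector gives a smaller one.
  obtain ⟨u, hu, hmin⟩ := hfin.exists_minimalFor (fun u => u 0 + u 1) B
    ⟨v, ⟨hv, hq, hbad⟩, le_rfl⟩
  obtain ⟨i, hi, hlt⟩ := exists_sigmaInv_mem (hpos u hu).1 (hpos u hu).2
  obtain ⟨⟨h1, h2, h3⟩, h4⟩ := hu
  have hiu := (isVeechPair_sigma i).apply_apply u
  have : ∃ w, ∃ c : ℝ, 0 < c ∧ (sigmaInv i).mulVec u = (m w).mulVec ![c, 0] := by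
    by_contra hcon
    refine absurd (hmin ⟨⟨?_, hi, hcon⟩, hlt.le.trans h4⟩ hlt.le) (not_le.2 hlt)
    exact h1.imp (isVeechPair_sigma i).symm.saddleConnection_iff.2
      (isVeechPair_sigma i).symm.cylinder_iff.2
  obtain ⟨w, c, hc, he⟩ := this
  refine h3 ⟨w ++ [i], c, hc, ?_⟩
  rw [m_append_singleton, ← Matrix.mulVec_mulVec, ← he, hiu]

/-! ### Long and short vectors in all directions -/

theorem smul_vec (c d : ℝ) : c • (![d, 0] : Fin 2 → ℝ) = ![c * d, 0] := by
  ext i; fin_cases i <;> simp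

theorem long_iff_eq_one {c : ℝ} (hc : 0 < c) :
    ![c, 0] ∈ longSaddleConnectionVectors ↔ c = 1 := by
  simp only [longSaddleConnectionVectors, mem_ofPred_eq, smul_vec]
  constructor
  · rintro ⟨h1, h2⟩
    refine le_antisymm (le_one_of_smul_e1_mem_saddleConnectionVectors hc h1) ?_
    have := h2 c⁻¹ (inv_pos.2 hc) (by
      rw [inv_mul_cancel₀ hc.ne']; exact e1_mem_saddleConnectionVectors)
    exact (inv_le_one₀ hc).1 this
  · rintro rfl
    refine ⟨e1_mem_saddleConnectionVectors, fun d hd h => ?_⟩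
    rw [mul_one] at h
    exact le_one_of_smul_e1_mem_saddleConnectionVectors hd h

theorem short_iff_eq_one {c : ℝ} (hc : 0 < c) : ![c, 0] ∈ shortCylinderVectors ↔ c = 1 := by
  simp only [shortCylinderVectors, mem_ofPred_eq, smul_vec]
  constructor
  · rintro ⟨h1, h2⟩
    refine le_antisymm ?_ (one_le_of_smul_e1_mem_cylinderVectors hc h1)
    have := h2 c⁻¹ (inv_pos.2 hc) (by
      rw [inv_mul_cancel₀ hc.ne']; exact e1_mem_cylinderVectors)
    exact (one_le_inv₀ hc).1 this
  · rintro rfl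
    refine ⟨e1_mem_cylinderVectors, fun d hd h => ?_⟩
    rw [mul_one] at h
    exact one_le_of_smul_e1_mem_cylinderVectors hd h

theorem long_iff_of_mem_firstQuadrant {v : Fin 2 → ℝ} (hq : v ∈ firstQuadrant) :
    v ∈ longSaddleConnectionVectors ↔ ∃ w, (m w).mulVec ![1, 0] = v := by
  constructor
  · intro h
    obtain ⟨w, c, hc, rfl⟩ := exists_word (Or.inl h.1) hq
    obtain ⟨B, hB⟩ := exists_isVeechPair_m w
    rw [hB.long_iff, long_iff_eq_one hc] at h
    exact ⟨w, by rw [h]⟩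
  · rintro ⟨w, rfl⟩
    obtain ⟨B, hB⟩ := exists_isVeechPair_m w
    rw [hB.long_iff, long_iff_eq_one zero_lt_one]

theorem short_iff_of_mem_firstQuadrant {v : Fin 2 → ℝ} (hq : v ∈ firstQuadrant) :
    v ∈ shortCylinderVectors ↔ ∃ w, (m w).mulVec ![1, 0] = v := by
  constructor
  · intro h
    obtain ⟨w, c, hc, rfl⟩ := exists_word (Or.inr h.1) hq
    obtain ⟨B, hB⟩ := exists_isVeechPair_m w
    rw [hB.short_iff, short_iff_eq_one hc] at h
    exact ⟨w, by rw [h]⟩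
  · rintro ⟨w, rfl⟩
    obtain ⟨B, hB⟩ := exists_isVeechPair_m w
    rw [hB.short_iff, short_iff_eq_one zero_lt_one]

/-- Every nonzero vector is rotated into the first quadrant by a multiple of a quarter turn. -/
theorem exists_isVeechPair_mulVec_mem {v : Fin 2 → ℝ} (hv : v ≠ 0) :
    ∃ A B, IsVeechPair A B ∧ A.mulVec v ∈ firstQuadrant := by
  have hR := isVeechPair_rotation
  have hv' : v 0 ≠ 0 ∨ v 1 ≠ 0 := by
    by_contra! h
    exact hv (by ext i; fin_cases i <;> simp [h.1, h.2])
  by_cases h1 : 0 < v 0 ∧ 0 ≤ v 1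
  · exact ⟨1, 1, .one, by rw [Matrix.one_mulVec]; exact h1⟩
  by_cases h2 : 0 < v 1 ∧ v 0 ≤ 0
  · refine ⟨_, _, hR.symm, ?_⟩
    simp [firstQuadrant, dotProduct, Fin.sum_univ_two, h2]
  by_cases h3 : v 0 < 0 ∧ v 1 ≤ 0
  · refine ⟨_, _, hR.mul hR, ?_⟩
    simp [firstQuadrant, dotProduct, Fin.sum_univ_two, h3]
  · refine ⟨_, _, hR, ?_⟩
    have : v 1 < 0 ∧ 0 ≤ v 0 := by grind
    simp [firstQuadrant, dotProduct, Fin.sum_univ_two, this]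

theorem long_eq_short : longSaddleConnectionVectors = shortCylinderVectors := by
  ext v
  by_cases hv : v = 0
  · exact ⟨fun h => absurd hv h.1.1, fun h => absurd hv h.1.1⟩
  · obtain ⟨A, B, hA, hq⟩ := exists_isVeechPair_mulVec_mem hv
    rw [← hA.long_iff, ← hA.short_iff, long_iff_of_mem_firstQuadrant hq,
      short_iff_of_mem_firstQuadrant hq]

theorem range_m_mulVec :
    range (fun w : List (Fin 4) => (m w).mulVec ![1, 0]) = Lam := by
  ext v
  constructor
  · rintro ⟨w, rfl⟩
    have hq := m_mulVec_mem w e1_mem_firstQuadrant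
    exact ⟨(long_iff_of_mem_firstQuadrant hq).2 ⟨w, rfl⟩, hq⟩
  · rintro ⟨h, hq⟩
    exact (long_iff_of_mem_firstQuadrant hq).1 h

/-! ### Uniqueness of the word -/

theorem sigma_zero_mulVec_e1 : (sigma 0).mulVec ![1, 0] = ![1, 0] := by
  ext i; fin_cases i <;> simp [sigma]

theorem exists_reduced_word (w : List (Fin 4)) :
    ∃ w' : List (Fin 4), w'.head? ≠ some 0 ∧
      (m w').mulVec ![1, 0] = (m w).mulVec (![1, 0] : Fin 2 → ℝ) := by
  induction w with
  | nil => exact ⟨[], by simp, rfl⟩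
  | cons k w ih =>
    by_cases hk : k = 0
    · obtain ⟨w', h1, h2⟩ := ih
      refine ⟨w', h1, ?_⟩
      rw [h2, hk, m, ← Matrix.mulVec_mulVec, sigma_zero_mulVec_e1]
    · exact ⟨k :: w, by simpa using hk, rfl⟩

/-- e₁ lies in the sector of σ₀, so the last letter is 0, and removing it again leaves a word that
fixes e₁. -/
theorem eq_zero_of_mem_of_m_mulVec {w : List (Fin 4)}
    (h : (m w).mulVec (![1, 0] : Fin 2 → ℝ) = ![1, 0]) : ∀ k ∈ w, k = 0 := by
  induction w using List.reverseRecOn with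
  | nil => simp
  | append_singleton w k ih =>
    -- This rewrites e₁ as σ₀e₁ on both sides; only the right-hand one is wanted, and the other is
    -- undone below.
    rw [m_append_singleton, ← Matrix.mulVec_mulVec, ← sigma_zero_mulVec_e1] at h
    obtain ⟨hk, he⟩ := sigma_mulVec_inj
      (m_mulVec_mem w (by rw [sigma_zero_mulVec_e1]; exact e1_mem_firstQuadrant))
      e1_mem_firstQuadrant h
    rw [sigma_zero_mulVec_e1] at he
    simpa [or_imp, forall_and, hk] using ih he

theorem eq_nil_of_m_mulVec {w : List (Fin 4)} (hw : w.head? ≠ some 0)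
    (h : (m w).mulVec (![1, 0] : Fin 2 → ℝ) = ![1, 0]) : w = [] := by
  cases w with
  | nil => rfl
  | cons k w =>
    have := eq_zero_of_mem_of_m_mulVec h k (by simp)
    simp [this] at hw

theorem head?_ne_of_append {w : List (Fin 4)} {k : Fin 4} (h : (w ++ [k]).head? ≠ some 0) :
    w.head? ≠ some 0 := by
  cases w with
  | nil => simp
  | cons a w => simpa using h

/-- The last letter is the outermost matrix, hence is read off from the sector of the vector; so the
induction removes letters from the end. -/
theorem m_mulVec_inj {w w' : List (Fin 4)} (hw : w.head? ≠ some 0) (hw' : w'.head? ≠ some 0)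
    (h : (m w).mulVec (![1, 0] : Fin 2 → ℝ) = (m w').mulVec ![1, 0]) : w = w' := by
  induction w using List.reverseRecOn generalizing w' with
  | nil =>
    rw [m, Matrix.one_mulVec] at h
    exact (eq_nil_of_m_mulVec hw' h.symm).symm
  | append_singleton w k ih =>
    rcases List.eq_nil_or_concat w' with rfl | ⟨w', k', rfl⟩
    · refine eq_nil_of_m_mulVec hw ?_
      rwa [m, Matrix.one_mulVec] at h
    · rw [List.concat_eq_append] at *
      rw [m_append_singleton, m_append_singleton, ← Matrix.mulVec_mulVec,
        ← Matrix.mulVec_mulVec] at h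
      obtain ⟨rfl, he⟩ := sigma_mulVec_inj (m_mulVec_mem w e1_mem_firstQuadrant)
        (m_mulVec_mem w' e1_mem_firstQuadrant) h
      rw [ih (head?_ne_of_append hw) (head?_ne_of_append hw') he]

end GoldenL

theorem theorem2 :
    GoldenL.longSaddleConnectionVectors = GoldenL.shortCylinderVectors ∧
    Set.range (fun w : List (Fin 4) => (GoldenL.m w).mulVec ![1, 0]) = GoldenL.Lam ∧
    Set.BijOn (fun w : List (Fin 4) => (GoldenL.m w).mulVec ![1, 0])
      {w : List (Fin 4) | w.head? ≠ some 0} GoldenL.Lam := by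
  refine ⟨GoldenL.long_eq_short, GoldenL.range_m_mulVec, ?_, ?_, ?_⟩
  · intro w _
    rw [← GoldenL.range_m_mulVec]
    exact ⟨w, rfl⟩
  · intro w hw w' hw' h
    exact GoldenL.m_mulVec_inj hw hw' h
  · rw [← GoldenL.range_m_mulVec]
    rintro _ ⟨w, rfl⟩
    obtain ⟨w', h1, h2⟩ := GoldenL.exists_reduced_word w
    exact ⟨w', h1, h2⟩
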